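/- Let $n_1,n_2\ge 1$ and write $H(\mathbb{C}^m)$ for the space of entire functions on $\mathbb{C}^m$ with the topology of uniform convergence on compact sets. A *polynomial projector of degree $d$* on $H(\mathbb{C}^m)$ is a continuous linear projector $\Pi$ of $H(\mathbb{C}^m)$ onto the space of polynomials of total degree at most $d$; its space of interpolation conditions $\mathcal{I}(\Pi)$ is the set of continuous linear forms $\nu$ on $H(\mathbb{C}^m)$ with $\nu(f)=\nu(\Pi f)$ for all $f$. A *Newton sequence* on $H(\mathbb{C}^m)$ is a sequence $\mathcal{N}=(\Pi_0,\Pi_1,\dots)$, where $\Pi_d$ is a polynomial projector of degree $d$ and $\mathcal{I}(\Pi_d)\subset\mathcal{I}(\Pi_{d+1})$ for all $d$. A *Newton structure* for it is a sequence of spaces $J_0,J_1,\dots$ of continuous linear forms with $\mathcal{I}(\Pi_d)=J_0\oplus\dots\oplus J_d$ for all $d$. We say that $\mathcal{N}$ *converges on* $E\subset H(\mathbb{C}^m)$ if $\Pi_d(f)\to f$ uniformly on compact sets for every $f\in E$. Let $\mathcal{N}^s$ be a Newton sequence on $H(\mathbb{C}^{n_s})$, $s=1,2$. A *Newton product* $\mathcal{N}^1\boxtimes\mathcal{N}^2$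 is a Newton sequence $(\Pi_d)$ on $H(\mathbb{C}^{n_1}\times\mathbb{C}^{n_2})$ such that, for some Newton structures $(J^1_i)$, $(J^2_j)$ of $\mathcal{N}^1$, $\mathcal{N}^2$, for all $d$, $$\mathcal{I}(\Pi_d)=\sum_{i+j\le d}J^1_i\otimes J^2_j ,$$ where $J\otimes J'$ is the span of the functionals $\mu\otimes\mu'$ $(\mu\in J,\ \mu'\in J')$, and $\mu\otimes\mu'$ is the continuous linear form taking the value $\mu(f_1)\mu'(f_2)$ at $f_1(z^1)f_2(z^2)$. Let $N_s$ be a norm on $\mathbb{C}^{n_s}$, $s=1,2$, whose unit ball is poly-circular: $N_s(z)\le1$ and $|\lambda_i|=1$ for all $i$ imply $N_s(\lambda_1z_1,\dots,\lambda_{n_s}z_{n_s})\le1$. For $\omega>0$ and a norm $N$ on $\mathbb{C}^m$, the $\omega$-type of $f\in H(\mathbb{C}^m)$ with respect to $N$ is $$\limsup_{r\to\infty}\frac{\ln\max_{N(z)\le r}|f(z)|}{r^{\omega}},$$ where the zero function is given $\omega$-type $0$. Suppose $0<\omega\le1$. Then $\mathcal{N}^1\boxtimes\mathcal{N}^2$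 exists and is unique (in particular it does not depend on the Newton structures), and: 1. For all $\tau_1,\tau_2>0$: if, for $s=1,2$, $\mathcal{N}^s$ converges on the set of entire functions on $\mathbb{C}^{n_s}$ of $\omega$-type $<\tau_s$ with respect to $N_s$, then $\mathcal{N}^1\boxtimes\mathcal{N}^2$ converges on the set of entire functions on $\mathbb{C}^{n_1}\times\mathbb{C}^{n_2}$ of $\omega$-type $<1$ with respect to the norm $N(z^1,z^2)=\tau_1^{1/\omega}N_1(z^1)+\tau_2^{1/\omega}N_2(z^2)$. 2. For all $\tau>0$: if, for $s=1,2$, $\mathcal{N}^s$ converges on the set of entire functions on $\mathbb{C}^{n_s}$ of $\omega$-type $<\tau$ with respect to $N_s$, then $\mathcal{N}^1\boxtimes\mathcal{N}^2$ converges on the set of entire functions on $\mathbb{C}^{n_1}\times\mathbb{C}^{n_2}$ of $\omega$-type $<\tau$ with respect to the norm $N(z^1,z^2)=N_1(z^1)+N_2(z^2)$. -/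

import Mathlib

open Filter Topology

noncomputable section

/-- The space of entire functions on `ℂ^ι`, as a subspace of `C(ℂ^ι, ℂ)`. Its topology is the one
induced by the compact-open topology, i.e. uniform convergence on compact subsets. -/
def entireSubmodule (ι : Type) [Fintype ι] : Submodule ℂ C(ι → ℂ, ℂ) where
  carrier := {f | Differentiable ℂ (f : (ι → ℂ) → ℂ)}
  add_mem' := fun {f g} hf hg => by
    have h : Differentiable ℂ ((f : (ι → ℂ) → ℂ) + (g : (ι → ℂ) → ℂ)) := hf.add hg
    simpa using h
  zero_mem' := by
    have h : Differentiable ℂ (fun _ : ι → ℂ => (0 : ℂ)) := differentiable_const 0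
    exact h
  smul_mem' := fun c f hf => by
    have h : Differentiable ℂ (c • (f : (ι → ℂ) → ℂ)) := Differentiable.const_smul hf c
    simpa using h

/-- `H(ℂ^ι)`, with the topology of uniform convergence on compact sets. -/
abbrev Entire (ι : Type) [Fintype ι] : Type := entireSubmodule ι

/-- The space `H(ℂ^ι)'` of continuous linear forms. -/
abbrev EntireDual (ι : Type) [Fintype ι] : Type := Entire ι →L[ℂ] ℂ

/-- The product function `(z¹, z²) ↦ f₁(z¹) f₂(z²)` on `ℂ^ι₁ × ℂ^ι₂ = ℂ^(ι₁ ⊕ ι₂)`. -/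
def Entire.prod {ι₁ ι₂ : Type} [Fintype ι₁] [Fintype ι₂] (f₁ : Entire ι₁) (f₂ : Entire ι₂) :
    Entire (ι₁ ⊕ ι₂) :=
  ⟨⟨fun z => f₁.1 (fun i => z (Sum.inl i)) * f₂.1 (fun j => z (Sum.inr j)), by fun_prop⟩, by
    have h₁ : Differentiable ℂ (f₁.1 : (ι₁ → ℂ) → ℂ) := f₁.2
    have h₂ : Differentiable ℂ (f₂.1 : (ι₂ → ℂ) → ℂ) := f₂.2
    have l₁ : Differentiable ℂ (fun (z : ι₁ ⊕ ι₂ → ℂ) (i : ι₁) => z (Sum.inl i)) := by fun_prop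
    have l₂ : Differentiable ℂ (fun (z : ι₁ ⊕ ι₂ → ℂ) (j : ι₂) => z (Sum.inr j)) := by fun_prop
    exact (h₁.comp l₁).mul (h₂.comp l₂)⟩

/-! ### Polynomial projectors and Newton sequences -/

/-- `f` is (the function of) a polynomial of total degree at most `d`. -/
def IsPolyDegreeLE {ι : Type} [Fintype ι] (d : ℕ) (f : Entire ι) : Prop :=
  ∃ p : MvPolynomial ι ℂ, p.totalDegree ≤ d ∧ ∀ z : ι → ℂ, f.1 z = MvPolynomial.eval z p

/-- A polynomial projector of degree `d` on `H(ℂ^ι)`: a continuous linear projector of `H(ℂ^ι)`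
onto the space of polynomials of total degree at most `d` (so that `Π ∘ Π = Π`). -/
structure IsPolyProjector {ι : Type} [Fintype ι] (d : ℕ) (P : Entire ι →L[ℂ] Entire ι) : Prop where
  maps_to : ∀ f, IsPolyDegreeLE d (P f)
  fixes : ∀ f, IsPolyDegreeLE d f → P f = f

/-- The space of interpolation conditions of `P`: the continuous linear forms `ν` with
`ν(f) = ν(P f)` for all `f`. -/
def interpSpace {ι : Type} [Fintype ι] (P : Entire ι →L[ℂ] Entire ι) :
    Submodule ℂ (EntireDual ι) where
  carrier := {ν | ∀ f, ν f = ν (P f)}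
  add_mem' := fun {μ ν} hμ hν f => by
    simp only [_root_.add_apply]
    rw [hμ f, hν f]
  zero_mem' := fun f => by simp
  smul_mem' := fun c ν hν f => by
    simp only [_root_.smul_apply]
    rw [hν f]

/-- A Newton sequence on `H(ℂ^ι)`: polynomial projectors `Π_d` of degree `d`, `d = 0, 1, 2, …`,
whose spaces of interpolation conditions are nested. -/
structure NewtonSequence (ι : Type) [Fintype ι] where
  proj : ℕ → (Entire ι →L[ℂ] Entire ι)
  isPolyProjector : ∀ d, IsPolyProjector d (proj d)
  nested : ∀ d, interpSpace (proj d) ≤ interpSpace (proj (d + 1))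

/-- The spaces `J_0, J_1, …` form a Newton structure for the Newton sequence: for every `d`,
the space of interpolation conditions of `Π_d` is the direct sum `J_0 ⊕ ⋯ ⊕ J_d`. -/
def NewtonSequence.IsNewtonStructure {ι : Type} [Fintype ι] (𝒩 : NewtonSequence ι)
    (J : ℕ → Submodule ℂ (EntireDual ι)) : Prop :=
  iSupIndep J ∧ ∀ d, interpSpace (𝒩.proj d) = ⨆ (i : ℕ) (_ : i ≤ d), J i

/-- `ν = μ₁ ⊗ μ₂`, as a continuous linear form on `H(ℂ^ι₁ × ℂ^ι₂)`. (The product functions span a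
dense subspace, so `ν` is determined by this.) -/
def IsTensor {ι₁ ι₂ : Type} [Fintype ι₁] [Fintype ι₂] (μ₁ : EntireDual ι₁) (μ₂ : EntireDual ι₂)
    (ν : EntireDual (ι₁ ⊕ ι₂)) : Prop :=
  ∀ (f₁ : Entire ι₁) (f₂ : Entire ι₂), ν (Entire.prod f₁ f₂) = μ₁ f₁ * μ₂ f₂

/-- The space `J₁ ⊗ J₂` spanned by the `μ₁ ⊗ μ₂` with `μ₁ ∈ J₁`, `μ₂ ∈ J₂`. -/
def tensorSpace {ι₁ ι₂ : Type} [Fintype ι₁] [Fintype ι₂] (J₁ : Submodule ℂ (EntireDual ι₁))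
    (J₂ : Submodule ℂ (EntireDual ι₂)) : Submodule ℂ (EntireDual (ι₁ ⊕ ι₂)) :=
  Submodule.span ℂ {ν | ∃ μ₁ ∈ J₁, ∃ μ₂ ∈ J₂, IsTensor μ₁ μ₂ ν}

/-- `𝒩` is the Newton product of `𝒩₁` and `𝒩₂`: its `d`-th projector has the space of
interpolation conditions `⨁_{i + j ≤ d} J¹_i ⊗ J²_j`. -/
def IsNewtonProduct {ι₁ ι₂ : Type} [Fintype ι₁] [Fintype ι₂] (𝒩₁ : NewtonSequence ι₁)
    (𝒩₂ : NewtonSequence ι₂) (𝒩 : NewtonSequence (ι₁ ⊕ ι₂)) : Prop :=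
  ∃ (J₁ : ℕ → Submodule ℂ (EntireDual ι₁)) (J₂ : ℕ → Submodule ℂ (EntireDual ι₂)),
    𝒩₁.IsNewtonStructure J₁ ∧ 𝒩₂.IsNewtonStructure J₂ ∧
    ∀ d, interpSpace (𝒩.proj d) =
      ⨆ (i : ℕ) (j : ℕ) (_ : i + j ≤ d), tensorSpace (J₁ i) (J₂ j)

/-- `Π_d(f) → f` in `H(ℂ^ι)`, i.e. uniformly on compact sets, for every `f` in `E`. -/
def NewtonSequence.ConvergesOn {ι : Type} [Fintype ι] (𝒩 : NewtonSequence ι)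
    (E : Set (Entire ι)) : Prop :=
  ∀ f ∈ E, Tendsto (fun d => 𝒩.proj d f) atTop (𝓝 f)

/-! ### Norms and growth -/

/-- A norm on `ℂ^ι` whose unit ball is poly-circular. -/
structure PCNorm (ι : Type) [Fintype ι] where
  toSeminorm : Seminorm ℂ (ι → ℂ)
  eq_zero : ∀ z, toSeminorm z = 0 → z = 0
  polyCircular : ∀ (z c : ι → ℂ), (∀ i, ‖c i‖ = 1) → toSeminorm z ≤ 1 →
    toSeminorm (fun i => c i * z i) ≤ 1

/-- Rotating the coordinates does not increase the value of a PC-norm. -/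
theorem PCNorm.rotate_le {ι : Type} [Fintype ι] (N : PCNorm ι) (z c : ι → ℂ)
    (hc : ∀ i, ‖c i‖ = 1) : N.toSeminorm (fun i => c i * z i) ≤ N.toSeminorm z := by
  rcases (apply_nonneg N.toSeminorm z).eq_or_lt with h | h
  · have hz := N.eq_zero z h.symm
    subst hz
    simp only [Pi.zero_apply, mul_zero]
    exact le_rfl
  · set t := N.toSeminorm z with ht
    have h1 := N.polyCircular (((t⁻¹ : ℝ) : ℂ) • z) c hc (by
      rw [map_smul_eq_mul, Complex.norm_real, Real.norm_of_nonneg (inv_nonneg.2 h.le), ← ht,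
        inv_mul_cancel₀ h.ne'])
    have h2 : (fun i => c i * (((t⁻¹ : ℝ) : ℂ) • z) i) = ((t⁻¹ : ℝ) : ℂ) • fun i => c i * z i := by
      ext i
      simp only [Pi.smul_apply, smul_eq_mul]
      ring
    rw [h2, map_smul_eq_mul, Complex.norm_real, Real.norm_of_nonneg (inv_nonneg.2 h.le)] at h1
    rwa [inv_mul_le_iff₀ h, mul_one] at h1

/-- The PC-norm `N(z¹, z²) = a₁ N₁(z¹) + a₂ N₂(z²)` on `ℂ^ι₁ × ℂ^ι₂`, where `a₁, a₂ > 0`. -/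
def PCNorm.weightedSum {ι₁ ι₂ : Type} [Fintype ι₁] [Fintype ι₂] (a₁ a₂ : ℝ) (ha₁ : 0 < a₁)
    (ha₂ : 0 < a₂) (N₁ : PCNorm ι₁) (N₂ : PCNorm ι₂) : PCNorm (ι₁ ⊕ ι₂) where
  toSeminorm := Seminorm.of
    (fun z => a₁ * N₁.toSeminorm (fun i => z (Sum.inl i))
      + a₂ * N₂.toSeminorm (fun j => z (Sum.inr j)))
    (fun x y => by
      have h₁ := map_add_le_add N₁.toSeminorm (fun i => x (Sum.inl i)) (fun i => y (Sum.inl i))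
      have h₂ := map_add_le_add N₂.toSeminorm (fun i => x (Sum.inr i)) (fun i => y (Sum.inr i))
      have h₃ := mul_le_mul_of_nonneg_left h₁ ha₁.le
      have h₄ := mul_le_mul_of_nonneg_left h₂ ha₂.le
      have e₁ : (fun i => (x + y) (Sum.inl i)) =
        (fun i => x (Sum.inl i)) + fun i : ι₁ => y (Sum.inl i) := rfl
      have e₂ : (fun i => (x + y) (Sum.inr i)) =
        (fun i => x (Sum.inr i)) + fun i : ι₂ => y (Sum.inr i) := rfl
      rw [e₁, e₂]
      linarith)
    (fun c x => by
      have e₁ : (fun i => (c • x) (Sum.inl i)) = c • fun i : ι₁ => x (Sum.inl i) := rfl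
      have e₂ : (fun i => (c • x) (Sum.inr i)) = c • fun i : ι₂ => x (Sum.inr i) := rfl
      rw [e₁, e₂, map_smul_eq_mul, map_smul_eq_mul]
      ring)
  eq_zero := fun z hz => by
    have hz' : a₁ * N₁.toSeminorm (fun i => z (Sum.inl i))
      + a₂ * N₂.toSeminorm (fun j => z (Sum.inr j)) = 0 := hz
    have p₁ := mul_nonneg ha₁.le (apply_nonneg N₁.toSeminorm (fun i => z (Sum.inl i)))
    have p₂ := mul_nonneg ha₂.le (apply_nonneg N₂.toSeminorm (fun i => z (Sum.inr i)))
    have q₁ := (mul_eq_zero.1 (by linarith :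
      a₁ * N₁.toSeminorm (fun i => z (Sum.inl i)) = 0)).resolve_left ha₁.ne'
    have q₂ := (mul_eq_zero.1 (by linarith :
      a₂ * N₂.toSeminorm (fun i => z (Sum.inr i)) = 0)).resolve_left ha₂.ne'
    ext k
    rcases k with i | j
    · exact congrFun (N₁.eq_zero _ q₁) i
    · exact congrFun (N₂.eq_zero _ q₂) j
  polyCircular := fun z c hc hz => by
    refine le_trans ?_ hz
    exact add_le_add
      (mul_le_mul_of_nonneg_left (N₁.rotate_le (fun i => z (Sum.inl i)) (fun i => c (Sum.inl i))
        (fun i => hc _)) ha₁.le)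
      (mul_le_mul_of_nonneg_left (N₂.rotate_le (fun i => z (Sum.inr i)) (fun i => c (Sum.inr i))
        (fun i => hc _)) ha₂.le)

/-- `M_N(f, r) = max {|f(z)| : N(z) ≤ r}`. -/
def maxModulus {ι : Type} [Fintype ι] (N : PCNorm ι) (f : Entire ι) (r : ℝ) : ℝ :=
  sSup ((fun z : ι → ℂ => ‖f.1 z‖) '' {z | N.toSeminorm z ≤ r})

/-- The `ω`-type `limsup_{r → ∞} ln M_N(f, r) / r^ω`, in `[-∞, ∞]`. (As `Real.log 0 = 0`, the zero
function has type `0` here, the value that it shares with the other constants.) -/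
def omegaType {ι : Type} [Fintype ι] (ω : ℝ) (N : PCNorm ι) (f : Entire ι) : EReal :=
  limsup (fun r : ℝ => ((Real.log (maxModulus N f r) / r ^ ω : ℝ) : EReal)) atTop

/-- The set of entire functions of `ω`-type `< τ` with respect to `N`. -/
def entireOfTypeLT {ι : Type} [Fintype ι] (ω : ℝ) (N : PCNorm ι) (τ : ℝ) : Set (Entire ι) :=
  {f | omegaType ω N f < (τ : EReal)}

end

/-! Write D_i = Π_i − Π_{i−1} for the Newton summands of each factor (`summand`). The product is Π_d
= Σ_{i+j≤d} D¹_i ⊗ D²_j (`productProj`). A projector is recovered from its interpolation conditions,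
so existence and uniqueness reduce to computing the conditions of this operator
(`interpSpace_productProj`) and seeing that every pair of Newton structures spans the same space
(`iSup_tensorSpace_newtonStructure`). Operators and forms on the product space are compared on
functions f₁(z¹)f₂(z²), which have dense span because the Taylor series converges in H(ℂ^m) and
monomials factor.

Convergence rests on geometric decay of the summands (`NewtonSequence.exists_decay`). If the Newton
sequence converges on type < τ and |f| ≤ A exp(t N^ω) with t < τ, Banach–Steinhaus on a weighted
Banach space bounds all D_i uniformly at an intermediate rate t'. Since D_i kills polynomials of
degree < i, f may be replaced by its Taylor remainder, which is smaller by a factor q^i at the rate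
t'. Hence D_i f = O(A q^i) on compact sets.

For f with |f(w,z)| ≤ A exp(t₁N₁(w)^ω) exp(t₂N₂(z)^ω), decay in z and then in w gives |(D¹_i ⊗ D²_j)
f| ≤ C q₁^i q₂^j, so the double series converges absolutely and uniformly on compact sets, and
iterated summation identifies its sum as f (`tendsto_productProj`). The condition ω ≤ 1 enters
through (a+b)^ω ≤ a^ω + b^ω, which splits a growth bound for the sum norm into such a product. -/

noncomputable section

/-! ### Holomorphic functions on finite-dimensional complex spaces -/

section Holomorphic

variable {E : Type*} [NormedAddCommGroup E] [NormedSpace ℂ E]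

/-- Cauchy's estimate for the Fréchet derivative. -/
theorem norm_fderiv_le_of_forall_norm_le {h : E → ℂ} (hh : Differentiable ℂ h) {y : E} {C : ℝ}
    (hC : ∀ u, ‖u‖ ≤ 1 → ‖h (y + u)‖ ≤ C) : ‖fderiv ℂ h y‖ ≤ C := by
  have hC0 : 0 ≤ C := (norm_nonneg _).trans (hC 0 (by simp))
  refine ContinuousLinearMap.opNorm_le_bound _ hC0 fun v => ?_
  rcases eq_or_ne v 0 with rfl | hv
  · simp
  have hv' : 0 < ‖v‖ := norm_pos_iff.2 hv
  have hl : ∀ t : ℂ, HasDerivAt (fun t : ℂ => y + t • v) v t := fun t => by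
    simpa using ((hasDerivAt_id t).smul_const v).const_add y
  have hφ : Differentiable ℂ (fun t : ℂ => h (y + t • v)) :=
    hh.comp fun t => (hl t).differentiableAt
  have hd : deriv (fun t : ℂ => h (y + t • v)) 0 = fderiv ℂ h y v := by
    have h1 : HasFDerivAt h (fderiv ℂ h y) (y + (0 : ℂ) • v) := by
      simpa using (hh y).hasFDerivAt
    exact (h1.comp_hasDerivAt 0 (hl 0)).deriv
  -- On the circle of radius ‖v‖⁻¹ the increment t • v has norm one, and Cauchy's bound C / ‖v‖⁻¹ is
  -- the required C * ‖v‖.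
  have := Complex.norm_deriv_le_of_forall_mem_sphere_norm_le (c := 0) (R := ‖v‖⁻¹) (C := C)
    (inv_pos.2 hv') hφ.diffContOnCl (fun t ht => hC _ (by
      rw [mem_sphere_zero_iff_norm] at ht
      rw [norm_smul, ht, inv_mul_cancel₀ hv'.ne']))
  rwa [hd, div_inv_eq_mul] at this

theorem differentiable_comp_smul {f : E → ℂ} (hf : Differentiable ℂ f) (z : E) :
    Differentiable ℂ (fun t : ℂ => f (t • z)) :=
  hf.comp (by fun_prop)

variable [FiniteDimensional ℂ E]

/-- A locally uniform limit of holomorphic functions of several variables is holomorphic. -/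
theorem differentiable_of_tendstoLocallyUniformly {α : Type*} {l : Filter α} [l.NeBot]
    {f : α → E → ℂ} {g : E → ℂ} (hf : ∀ n, Differentiable ℂ (f n))
    (h : TendstoLocallyUniformly f g l) : Differentiable ℂ g := by
  have : ProperSpace E := FiniteDimensional.proper ℂ E
  intro x
  have hu : TendstoUniformlyOn f g l (Metric.closedBall x 2) :=
    (tendstoLocallyUniformlyOn_iff_tendstoUniformlyOn_of_compact
      (isCompact_closedBall x 2)).1 h.tendstoLocallyUniformlyOn
  -- Unit balls centred in `ball x 1` stay in `closedBall x 2`, so Cauchy's estimate turns uniform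
  -- convergence there into uniformly Cauchy derivatives.
  have hc : UniformCauchySeqOn (fun n => fderiv ℂ (f n)) l (Metric.ball x 1) := by
    intro u hu'
    obtain ⟨ε, hε, hεu⟩ := Metric.mem_uniformity_dist.1 hu'
    filter_upwards [hu.uniformCauchySeqOn _ (Metric.dist_mem_uniformity (half_pos hε))]
      with p hp y hy
    refine hεu ?_
    have hd : Differentiable ℂ (f p.1 - f p.2) := (hf p.1).sub (hf p.2)
    rw [dist_eq_norm, ← fderiv_sub (hf _ _) (hf _ _)]
    refine (norm_fderiv_le_of_forall_norm_le hd (C := ε / 2) fun u hu1 => ?_).trans_lt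
      (half_lt_self hε)
    have hm : y + u ∈ Metric.closedBall x 2 := by
      rw [Metric.mem_closedBall, dist_eq_norm]
      rw [Metric.mem_ball, dist_eq_norm] at hy
      calc ‖y + u - x‖ = ‖(y - x) + u‖ := by congr 1; abel
        _ ≤ ‖y - x‖ + ‖u‖ := norm_add_le _ _
        _ ≤ 2 := by linarith
    have h2 := hp _ hm
    rw [dist_eq_norm] at h2
    exact h2.le
  have hlim : ∀ y ∈ Metric.ball x 1, ∃ L, Tendsto (fun n => fderiv ℂ (f n) y) l (𝓝 L) :=
    fun y hy => CompleteSpace.complete (hc.cauchy_map hy)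
  choose! g' hg' using hlim
  have hx : x ∈ Metric.ball x 1 := Metric.mem_ball_self one_pos
  exact (hasFDerivAt_of_tendstoUniformlyOn Metric.isOpen_ball
    (hc.tendstoUniformlyOn_of_tendsto hg') (fun n y _ => (hf n y).hasFDerivAt)
    (fun y hy => hu.tendsto_at (Metric.ball_subset_closedBall.trans
      (Metric.closedBall_subset_closedBall one_le_two) hy)) hx).differentiableAt

/-- The derivative at y is the derivative at z of the translate f(· + y − z). By uniform continuity
this translate is uniformly close to f near z, and Cauchy's estimate compares the derivatives. -/
theorem continuous_fderiv_of_differentiable {f : E → ℂ} (hf : Differentiable ℂ f) :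
    Continuous (fderiv ℂ f) := by
  have : ProperSpace E := FiniteDimensional.proper ℂ E
  rw [continuous_iff_continuousAt]
  intro z
  rw [Metric.continuousAt_iff]
  intro ε hε
  have huc := (isCompact_closedBall z 2).uniformContinuousOn_of_continuous
    hf.continuous.continuousOn
  obtain ⟨δ, hδ, hδf⟩ := Metric.uniformContinuousOn_iff.1 huc (ε / 2) (half_pos hε)
  refine ⟨min δ 1, lt_min hδ one_pos, fun y hy => ?_⟩
  have e : fderiv ℂ f y = fderiv ℂ (fun w => f (w + (y - z))) z := by
    rw [fderiv_comp_add_right]; simp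
  have hd : Differentiable ℂ (fun w => f (w + (y - z))) := hf.comp (by fun_prop)
  rw [dist_eq_norm, e, ← fderiv_fun_sub (hd z) (hf z)]
  refine (norm_fderiv_le_of_forall_norm_le (hd.sub hf) (C := ε / 2) fun u hu => ?_).trans_lt
    (half_lt_self hε)
  rw [dist_eq_norm, lt_min_iff] at hy
  have h1 : z + u + (y - z) ∈ Metric.closedBall z 2 := by
    rw [Metric.mem_closedBall, dist_eq_norm]
    calc ‖z + u + (y - z) - z‖ = ‖u + (y - z)‖ := by congr 1; abel
      _ ≤ ‖u‖ + ‖y - z‖ := norm_add_le _ _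
      _ ≤ 2 := by linarith
  have h2 : z + u ∈ Metric.closedBall z 2 := by
    rw [Metric.mem_closedBall, dist_eq_norm, add_sub_cancel_left]; linarith
  have := hδf _ h1 _ h2 (by rw [dist_eq_norm, add_sub_cancel_left]; exact hy.1)
  rw [dist_eq_norm] at this
  exact this.le

/-- The difference quotients in the direction v are holomorphic in x, and strict differentiability
makes them converge locally uniformly as t → 0. -/
theorem differentiable_fderiv_apply {f : E → ℂ} (hf : Differentiable ℂ f) (v : E) :
    Differentiable ℂ (fun x => fderiv ℂ f x v) := by
  have hcf := continuous_fderiv_of_differentiable hf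
  refine differentiable_of_tendstoLocallyUniformly (l := 𝓝[≠] (0 : ℂ))
    (f := fun t x => t⁻¹ • (f (x + t • v) - f x)) (fun t => ?_) ?_
  · have hd : Differentiable ℂ (fun x => f (x + t • v)) :=
      hf.comp (differentiable_id.add_const (t • v))
    exact (hd.sub hf).const_smul t⁻¹
  rw [tendstoLocallyUniformly_iff_filter]
  intro x
  rw [Metric.tendstoUniformlyOnFilter_iff]
  intro ε hε
  have hs : HasStrictFDerivAt f (fderiv ℂ f x) x :=
    hasStrictFDerivAt_of_hasFDerivAt_of_continuousAt
      (Eventually.of_forall fun y => (hf y).hasFDerivAt) hcf.continuousAt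
  have ho := hs.isLittleO
  have hv : 0 < ‖v‖ + 1 := by positivity
  have ht : Tendsto (fun p : ℂ × E => (p.2 + p.1 • v, p.2)) (𝓝[≠] 0 ×ˢ 𝓝 x) (𝓝 (x, x)) := by
    have hc : Continuous (fun p : ℂ × E => (p.2 + p.1 • v, p.2)) := by fun_prop
    have := hc.tendsto ((0 : ℂ), x)
    simp only [zero_smul, add_zero, nhds_prod_eq] at this
    rw [nhds_prod_eq]
    exact this.mono_left (prod_mono nhdsWithin_le_nhds le_rfl)
  -- Dividing by ‖v‖ + 1 rather than ‖v‖ covers v = 0; the quotient then differs from the derivative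
  -- at x by at most ε / 2.
  have h1 := ht.eventually (ho.def (c := ε / 2 / (‖v‖ + 1)) (by positivity))
  have h2 : ∀ᶠ p : ℂ × E in 𝓝[≠] 0 ×ˢ 𝓝 x, dist (fderiv ℂ f p.2 v) (fderiv ℂ f x v) < ε / 2 := by
    have hc : Continuous fun y => fderiv ℂ f y v := hcf.clm_apply continuous_const
    have : ∀ᶠ y in 𝓝 x, dist (fderiv ℂ f y v) (fderiv ℂ f x v) < ε / 2 :=
      hc.continuousAt.eventually (Metric.ball_mem_nhds _ (half_pos hε))
    exact this.prod_inr _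
  have h3 : ∀ᶠ p : ℂ × E in 𝓝[≠] 0 ×ˢ 𝓝 x, p.1 ≠ 0 :=
    (eventually_mem_nhdsWithin (a := (0 : ℂ)) (s := {0}ᶜ)).prod_inl _
  filter_upwards [h1, h2, h3] with p hp1 hp2 hp3
  have hp0 : 0 < ‖p.1‖ := norm_pos_iff.2 hp3
  simp only [add_sub_cancel_left, map_smul] at hp1
  have h4 : dist (fderiv ℂ f x v) (p.1⁻¹ • (f (p.2 + p.1 • v) - f p.2)) ≤ ε / 2 := by
    rw [dist_comm, dist_eq_norm]
    have e : p.1⁻¹ • (f (p.2 + p.1 • v) - f p.2) - fderiv ℂ f x v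
        = p.1⁻¹ • (f (p.2 + p.1 • v) - f p.2 - p.1 • fderiv ℂ f x v) := by
      rw [smul_sub p.1⁻¹ (f (p.2 + p.1 • v) - f p.2), inv_smul_smul₀ hp3]
    rw [e, norm_smul, norm_inv, inv_mul_le_iff₀ hp0]
    refine hp1.trans ?_
    rw [norm_smul, div_mul_eq_mul_div, div_le_iff₀ hv]
    nlinarith [norm_nonneg v, mul_pos hp0 hε]
  calc _ ≤ dist (fderiv ℂ f p.2 v) (fderiv ℂ f x v)
        + dist (fderiv ℂ f x v) (p.1⁻¹ • (f (p.2 + p.1 • v) - f p.2)) := dist_triangle _ _ _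
    _ < ε := by linarith

theorem contDiff_of_differentiable {f : E → ℂ} (hf : Differentiable ℂ f) (n : ℕ) :
    ContDiff ℂ n f := by
  induction n generalizing f with
  | zero => exact contDiff_zero.2 hf.continuous
  | succ n ih =>
    push_cast
    refine (contDiff_succ_iff_fderiv_apply (D := E)).2 ⟨hf, fun h => ?_, fun v =>
      ih (differentiable_fderiv_apply hf v)⟩
    simp at h

/-- The homogeneous Taylor term of degree `k` at the origin. -/
def taylorHom (f : E → ℂ) (k : ℕ) (z : E) : ℂ :=
  (k.factorial : ℂ)⁻¹ • iteratedFDeriv ℂ k f 0 (fun _ => z)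

/-- Restriction to the complex line through z reduces the Taylor expansion and Cauchy's inequalities
to one variable. -/
theorem taylorHom_eq_iteratedDeriv {f : E → ℂ} (hf : Differentiable ℂ f) (k : ℕ) (z : E) :
    taylorHom f k z = (k.factorial : ℂ)⁻¹ • iteratedDeriv k (fun t : ℂ => f (t • z)) 0 := by
  have h := ContinuousLinearMap.iteratedFDeriv_comp_right
    (ContinuousLinearMap.toSpanSingleton ℂ z : ℂ →L[ℂ] E)
    (contDiff_of_differentiable hf k) (0 : ℂ) (i := k) le_rfl
  have e : (f ∘ ContinuousLinearMap.toSpanSingleton ℂ z) = fun t : ℂ => f (t • z) := by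
    ext t; simp
  rw [e] at h
  rw [taylorHom, iteratedDeriv, h]
  simp

theorem hasSum_taylorHom {f : E → ℂ} (hf : Differentiable ℂ f) (z : E) :
    HasSum (fun k => taylorHom f k z) (f z) := by
  have h := Complex.hasSum_taylorSeries_of_entire (differentiable_comp_smul hf z) 0 1
  simpa [taylorHom_eq_iteratedDeriv hf] using h

theorem norm_taylorHom_le {f : E → ℂ} (hf : Differentiable ℂ f) (k : ℕ) (z : E) {r C : ℝ}
    (hr : 0 < r) (hC : ∀ t : ℂ, ‖t‖ = r → ‖f (t • z)‖ ≤ C) : ‖taylorHom f k z‖ ≤ C / r ^ k := by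
  have h := Complex.norm_iteratedDeriv_le_of_forall_mem_sphere_norm_le (c := 0) (C := C) k hr
    (differentiable_comp_smul hf z).diffContOnCl
    (fun t ht => hC t (mem_sphere_zero_iff_norm.1 ht))
  rw [taylorHom_eq_iteratedDeriv hf, norm_smul, norm_inv, Complex.norm_natCast,
    inv_mul_le_iff₀ (by positivity)]
  rwa [← mul_div_assoc]

end Holomorphic

/-- The homogeneous Taylor term of degree `k` at the origin, as a polynomial. -/
def taylorPoly {ι : Type} [Fintype ι] [DecidableEq ι] (f : (ι → ℂ) → ℂ) (k : ℕ) :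
    MvPolynomial ι ℂ :=
  ∑ s : Fin k → ι, MvPolynomial.C ((k.factorial : ℂ)⁻¹ *
    iteratedFDeriv ℂ k f 0 (fun j => Pi.single (s j) 1)) * ∏ j, MvPolynomial.X (s j)

theorem totalDegree_taylorPoly_le {ι : Type} [Fintype ι] [DecidableEq ι] (f : (ι → ℂ) → ℂ)
    (k : ℕ) : (taylorPoly f k).totalDegree ≤ k := by
  refine MvPolynomial.totalDegree_finsetSum_le fun s _ => ?_
  refine (MvPolynomial.totalDegree_mul _ _).trans ?_
  rw [MvPolynomial.totalDegree_C, zero_add]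
  refine (MvPolynomial.totalDegree_finsetProd _ _).trans ?_
  simp

theorem eval_taylorPoly {ι : Type} [Fintype ι] [DecidableEq ι] (f : (ι → ℂ) → ℂ)
    (k : ℕ) (z : ι → ℂ) : MvPolynomial.eval z (taylorPoly f k) = taylorHom f k z := by
  have hz : (fun _ : Fin k => z) = fun _ : Fin k => ∑ i, z i • Pi.single i (1 : ℂ) := by
    ext j i
    simp [Finset.sum_apply, Pi.single_apply]
  rw [taylorHom, hz, ContinuousMultilinearMap.map_sum, taylorPoly, map_sum, Finset.smul_sum]
  refine Finset.sum_congr rfl fun s _ => ?_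
  rw [ContinuousMultilinearMap.map_smul_univ]
  simp only [map_mul, map_prod, MvPolynomial.eval_C, MvPolynomial.eval_X, smul_eq_mul]
  ring

/-! ### The space of entire functions -/

section EntireSpace

variable {ι : Type} [Fintype ι]

/-! Shortcut instances: instance search is slow on `Entire ι`. -/

set_option synthInstance.maxHeartbeats 400000

instance : IsTopologicalAddGroup ℂ := inferInstance
instance : AddCommGroup C(ι → ℂ, ℂ) := inferInstance
instance : AddCommGroup (Entire ι) := inferInstance
instance : IsTopologicalAddGroup (Entire ι) := inferInstance
instance : ContinuousAdd (Entire ι) := inferInstance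

set_option synthInstance.maxHeartbeats 20000

theorem isClosed_entireSubmodule : IsClosed (entireSubmodule ι : Set C(ι → ℂ, ℂ)) := by
  refine isClosed_of_closure_subset fun f hf => ?_
  have := mem_closure_iff_comap_neBot.1 hf
  have ht : Tendsto (fun g : (entireSubmodule ι : Set C(ι → ℂ, ℂ)) => g.1) (comap Subtype.val (𝓝 f))
    (𝓝 f) := tendsto_comap
  exact differentiable_of_tendstoLocallyUniformly (fun g => g.2)
    (ContinuousMap.tendsto_iff_tendstoLocallyUniformly.1 ht)

theorem Entire.ext {f g : Entire ι} (h : ∀ z, f.1 z = g.1 z) : f = g :=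
  Subtype.ext (ContinuousMap.ext h)

theorem Entire.tendsto_iff {α : Type*} {l : Filter α} {F : α → Entire ι} {f : Entire ι} :
    Tendsto F l (𝓝 f) ↔
      ∀ K, IsCompact K → TendstoUniformlyOn (fun i z => (F i).1 z) f.1 l K := by
  rw [tendsto_subtype_rng, ContinuousMap.tendsto_iff_forall_isCompact_tendstoUniformlyOn]

theorem Entire.continuous_eval : Continuous fun p : Entire ι × (ι → ℂ) => p.1.1 p.2 :=
  (continuous_subtype_val.comp continuous_fst).eval continuous_snd

/-- A function into `Entire ι` that is jointly continuous is continuous. -/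
theorem Entire.continuous_of_uncurry {X : Type*} [TopologicalSpace X] {F : X → Entire ι}
    (h : Continuous fun p : X × (ι → ℂ) => (F p.1).1 p.2) : Continuous F :=
  (ContinuousMap.continuous_of_continuous_uncurry (fun x => (F x).1) h).subtype_mk _

/-- Evaluation at a point, as a continuous linear form. -/
def Entire.evalCLM (z : ι → ℂ) : Entire ι →L[ℂ] ℂ where
  toFun f := f.1 z
  map_add' _ _ := rfl
  map_smul' _ _ := rfl
  cont := Entire.continuous_eval.comp (continuous_id.prodMk continuous_const)

@[simp]
theorem Entire.evalCLM_apply (z : ι → ℂ) (f : Entire ι) : Entire.evalCLM z f = f.1 z := rfl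

/-- The entire function of a polynomial. -/
def polyEntire : MvPolynomial ι ℂ →ₗ[ℂ] Entire ι where
  toFun p := ⟨⟨fun z => MvPolynomial.eval z p, MvPolynomial.continuous_eval p⟩, by
    change Differentiable ℂ fun z => MvPolynomial.eval z p
    induction p using MvPolynomial.induction_on with
    | C a => simp
    | add p q hp hq =>
      simp only [map_add]
      exact hp.fun_add hq
    | mul_X p i hp =>
      simp only [map_mul, MvPolynomial.eval_X]
      exact hp.fun_mul (differentiable_apply i)⟩
  map_add' p q := Entire.ext fun z => map_add (MvPolynomial.eval z) p q
  map_smul' c p := Entire.ext fun z => MvPolynomial.smul_eval z p c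

@[simp]
theorem polyEntire_apply (p : MvPolynomial ι ℂ) (z : ι → ℂ) :
    (polyEntire p).1 z = MvPolynomial.eval z p := rfl

theorem isPolyDegreeLE_iff {d : ℕ} {f : Entire ι} :
    IsPolyDegreeLE d f ↔ ∃ p : MvPolynomial ι ℂ, p.totalDegree ≤ d ∧ polyEntire p = f :=
  ⟨fun ⟨p, hp, h⟩ => ⟨p, hp, Entire.ext fun z => (h z).symm⟩,
    fun ⟨p, hp, h⟩ => ⟨p, hp, fun z => by rw [← h, polyEntire_apply]⟩⟩

/-- The space of polynomials of total degree at most `d` in `Entire ι`. -/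
def polySubmodule (ι : Type) [Fintype ι] (d : ℕ) : Submodule ℂ (Entire ι) :=
  (MvPolynomial.restrictTotalDegree ι ℂ d).map polyEntire

theorem mem_polySubmodule {d : ℕ} {f : Entire ι} : f ∈ polySubmodule ι d ↔ IsPolyDegreeLE d f := by
  rw [isPolyDegreeLE_iff, polySubmodule, Submodule.mem_map]
  simp only [MvPolynomial.mem_restrictTotalDegree]

theorem IsPolyDegreeLE.mono {d e : ℕ} (h : d ≤ e) {f : Entire ι} (hf : IsPolyDegreeLE d f) :
    IsPolyDegreeLE e f :=
  let ⟨p, hp, hf⟩ := hf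
  ⟨p, hp.trans h, hf⟩

/-- The Taylor polynomial of degree less than `n`. -/
def taylorSum [DecidableEq ι] (f : Entire ι) (n : ℕ) : Entire ι :=
  ∑ k ∈ Finset.range n, polyEntire (taylorPoly f.1 k)

theorem taylorSum_apply [DecidableEq ι] (f : Entire ι) (n : ℕ) (z : ι → ℂ) :
    (taylorSum f n).1 z = ∑ k ∈ Finset.range n, taylorHom f.1 k z := by
  rw [← Entire.evalCLM_apply, taylorSum, map_sum]
  simp only [Entire.evalCLM_apply, polyEntire_apply, eval_taylorPoly]

theorem isPolyDegreeLE_taylorSum [DecidableEq ι] (f : Entire ι) (n : ℕ) :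
    IsPolyDegreeLE n (taylorSum f (n + 1)) := by
  rw [← mem_polySubmodule]
  refine Submodule.sum_mem _ fun k hk => ?_
  rw [mem_polySubmodule, isPolyDegreeLE_iff]
  exact ⟨_, (totalDegree_taylorPoly_le _ _).trans (Nat.lt_succ_iff.1 (Finset.mem_range.1 hk)), rfl⟩

theorem tendsto_taylorSum [DecidableEq ι] (f : Entire ι) :
    Tendsto (taylorSum f) atTop (𝓝 f) := by
  rw [Entire.tendsto_iff]
  intro K hK
  -- A circle of radius 2 > 1 makes Cauchy's inequality bound the k-th term by C / 2 ^ k uniformly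
  -- on K.
  have hK' : IsCompact ((fun p : ℂ × (ι → ℂ) => p.1 • p.2) '' (Metric.sphere 0 2 ×ˢ K)) :=
    ((isCompact_sphere 0 2).prod hK).image continuous_smul
  obtain ⟨C, hC⟩ := hK'.exists_bound_of_continuousOn f.1.continuous.continuousOn
  have hs : Summable fun k : ℕ => C / 2 ^ k := by
    simpa [div_eq_mul_inv] using (summable_geometric_two).mul_left C
  have h := tendstoUniformlyOn_tsum_nat (f := fun k z => taylorHom f.1 k z) hs (s := K)
    fun k z hz => norm_taylorHom_le f.2 k z two_pos fun t ht =>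
      hC _ ⟨(t, z), ⟨mem_sphere_zero_iff_norm.2 ht, hz⟩, rfl⟩
  have e : (fun z => ∑' k, taylorHom f.1 k z) = f.1 :=
    funext fun z => (hasSum_taylorHom f.2 z).tsum_eq
  rw [e] at h
  simpa only [taylorSum_apply] using h

theorem denseRange_polyEntire : DenseRange (polyEntire (ι := ι)) := by
  classical
  refine fun f => mem_closure_of_tendsto (tendsto_taylorSum f) (Eventually.of_forall fun n => ?_)
  exact ⟨∑ k ∈ Finset.range n, taylorPoly f.1 k, map_sum _ _ _⟩

/-- Continuous linear forms separate entire functions. -/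
theorem Entire.eq_of_forall_dual {f g : Entire ι} (h : ∀ μ : EntireDual ι, μ f = μ g) : f = g :=
  Entire.ext fun z => h (Entire.evalCLM z)

end EntireSpace

/-! ### Tensor products -/

section Tensor

variable {ι₁ ι₂ : Type} [Fintype ι₁] [Fintype ι₂]

/-- Every monomial is a product of monomials in the two groups of variables. -/
theorem exists_prod_eq_monomial (s : (ι₁ ⊕ ι₂) →₀ ℕ) :
    ∃ (p : MvPolynomial ι₁ ℂ) (q : MvPolynomial ι₂ ℂ),
      p.totalDegree + q.totalDegree ≤ s.sum (fun _ e => e) ∧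
      polyEntire (MvPolynomial.monomial s 1) = Entire.prod (polyEntire p) (polyEntire q) := by
  refine ⟨MvPolynomial.monomial (Finsupp.equivFunOnFinite.symm fun i => s (Sum.inl i)) 1,
    MvPolynomial.monomial (Finsupp.equivFunOnFinite.symm fun i => s (Sum.inr i)) 1, ?_, ?_⟩
  · rw [MvPolynomial.totalDegree_monomial _ one_ne_zero,
      MvPolynomial.totalDegree_monomial _ one_ne_zero,
      Finsupp.sum_fintype _ _ (fun _ => rfl), Finsupp.sum_fintype _ _ (fun _ => rfl),
      Finsupp.sum_fintype _ _ (fun _ => rfl), Fintype.sum_sum_type]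
    simp
  · refine Entire.ext fun z => ?_
    change MvPolynomial.eval z _ = MvPolynomial.eval (fun i => z (Sum.inl i)) _ *
      MvPolynomial.eval (fun j => z (Sum.inr j)) _
    simp only [MvPolynomial.eval_monomial, one_mul]
    rw [Finsupp.prod_fintype _ _ (fun _ => pow_zero _),
      Finsupp.prod_fintype _ _ (fun _ => pow_zero _),
      Finsupp.prod_fintype _ _ (fun _ => pow_zero _), Fintype.prod_sum_type]
    simp

/-- Each monomial factors with its degree split between the two groups. Keeping track of d serves
the proof that the product projector fixes polynomials; density of products needs no bound. -/
theorem polyEntire_mem_of_prod_mem {S : Submodule ℂ (Entire (ι₁ ⊕ ι₂))} {d : ℕ}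
    (hS : ∀ (p : MvPolynomial ι₁ ℂ) (q : MvPolynomial ι₂ ℂ), p.totalDegree + q.totalDegree ≤ d →
      Entire.prod (polyEntire p) (polyEntire q) ∈ S)
    {p : MvPolynomial (ι₁ ⊕ ι₂) ℂ} (hp : p.totalDegree ≤ d) : polyEntire p ∈ S := by
  rw [MvPolynomial.as_sum p, map_sum]
  refine Submodule.sum_mem _ fun s hs => ?_
  obtain ⟨q₁, q₂, hd, h⟩ := exists_prod_eq_monomial s
  have e : MvPolynomial.monomial s (p.coeff s) = p.coeff s • MvPolynomial.monomial s (1 : ℂ) := by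
    rw [MvPolynomial.smul_monomial, smul_eq_mul, mul_one]
  rw [e, map_smul, h]
  exact S.smul_mem _ (hS _ _ (hd.trans ((MvPolynomial.le_totalDegree hs).trans hp)))

/-- The product functions span a dense subspace. -/
theorem Entire.mem_of_prod_mem {S : Submodule ℂ (Entire (ι₁ ⊕ ι₂))}
    (hc : IsClosed (S : Set (Entire (ι₁ ⊕ ι₂)))) (hS : ∀ f₁ f₂, Entire.prod f₁ f₂ ∈ S)
    (f : Entire (ι₁ ⊕ ι₂)) : f ∈ S :=
  denseRange_polyEntire.induction_on f hc fun _ =>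
    polyEntire_mem_of_prod_mem (fun _ _ _ => hS _ _) le_rfl

theorem ext_of_prod {M : Type*} [AddCommGroup M] [Module ℂ M] [TopologicalSpace M] [T2Space M]
    {S T : Entire (ι₁ ⊕ ι₂) →L[ℂ] M}
    (h : ∀ f₁ f₂, S (Entire.prod f₁ f₂) = T (Entire.prod f₁ f₂)) : S = T :=
  ContinuousLinearMap.ext <| Entire.mem_of_prod_mem
    (S := LinearMap.eqLocus (S : Entire (ι₁ ⊕ ι₂) →ₗ[ℂ] M) T) (isClosed_eq S.cont T.cont) h

/-- The partial function `f(w, ·)`. -/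
def Entire.slice (f : Entire (ι₁ ⊕ ι₂)) (w : ι₁ → ℂ) : Entire ι₂ :=
  ⟨⟨fun z => f.1 (Sum.elim w z), by
    refine f.1.continuous.comp (continuous_pi fun k => ?_)
    rcases k with i | j
    · exact continuous_const
    · exact continuous_apply j⟩, by
    have hf : Differentiable ℂ f.1 := f.2
    refine hf.comp (differentiable_pi.2 fun k => ?_)
    rcases k with i | j
    · exact differentiable_const _
    · exact differentiable_apply j⟩

@[simp]
theorem Entire.slice_apply (f : Entire (ι₁ ⊕ ι₂)) (w : ι₁ → ℂ) (z : ι₂ → ℂ) :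
    (f.slice w).1 z = f.1 (Sum.elim w z) := rfl

theorem Entire.continuous_slice :
    Continuous fun p : Entire (ι₁ ⊕ ι₂) × (ι₁ → ℂ) => p.1.slice p.2 := by
  refine Entire.continuous_of_uncurry ?_
  refine Entire.continuous_eval.comp ((continuous_fst.comp continuous_fst).prodMk
    (continuous_pi fun k => ?_))
  rcases k with i | j
  · exact (continuous_apply i).comp (continuous_snd.comp continuous_fst)
  · exact (continuous_apply j).comp continuous_snd

/-- Exchange of the two groups of variables. -/
def Entire.swap : Entire (ι₁ ⊕ ι₂) →L[ℂ] Entire (ι₂ ⊕ ι₁) where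
  toFun f := ⟨⟨fun z => f.1 (fun k => z k.swap), by fun_prop⟩, by
    have hf : Differentiable ℂ f.1 := f.2
    exact hf.comp (differentiable_pi.2 fun k => differentiable_apply k.swap)⟩
  map_add' _ _ := rfl
  map_smul' _ _ := rfl
  cont := Entire.continuous_of_uncurry <| Entire.continuous_eval.comp <|
    continuous_fst.prodMk <| continuous_pi fun k => (continuous_apply k.swap).comp continuous_snd

theorem Entire.swap_prod (f₁ : Entire ι₁) (f₂ : Entire ι₂) :
    Entire.swap (Entire.prod f₁ f₂) = Entire.prod f₂ f₁ :=
  Entire.ext fun _ => mul_comm _ _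

/-- `1 ⊗ Q` with values in the continuous functions. -/
def sndAux (Q : Entire ι₂ →L[ℂ] Entire ι₂) : Entire (ι₁ ⊕ ι₂) →L[ℂ] C(ι₁ ⊕ ι₂ → ℂ, ℂ) :=
  have hc : Continuous fun p : Entire (ι₁ ⊕ ι₂) × (ι₁ ⊕ ι₂ → ℂ) =>
      (Q (p.1.slice fun i => p.2 (Sum.inl i))).1 (fun j => p.2 (Sum.inr j)) :=
    Entire.continuous_eval.comp <| (Q.cont.comp <| Entire.continuous_slice.comp <|
      continuous_fst.prodMk <| by fun_prop).prodMk (by fun_prop)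
  { toFun f := ⟨fun z => (Q (f.slice fun i => z (Sum.inl i))).1 (fun j => z (Sum.inr j)),
      hc.comp (continuous_const.prodMk continuous_id)⟩
    map_add' f g := ContinuousMap.ext fun z => by
      have e : (f + g).slice (fun i => z (Sum.inl i))
        = f.slice (fun i => z (Sum.inl i)) + g.slice (fun i => z (Sum.inl i)) := rfl
      simp only [ContinuousMap.coe_mk, e, map_add, ContinuousMap.add_apply]
      rfl
    map_smul' c f := ContinuousMap.ext fun z => by
      have e : (c • f).slice (fun i => z (Sum.inl i)) = c • f.slice (fun i => z (Sum.inl i)) := rfl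
      simp only [ContinuousMap.coe_mk, e, map_smul, ContinuousMap.smul_apply]
      rfl
    cont := ContinuousMap.continuous_of_continuous_uncurry _ hc }

theorem slice_prod (f₁ : Entire ι₁) (f₂ : Entire ι₂) (w : ι₁ → ℂ) :
    (Entire.prod f₁ f₂).slice w = f₁.1 w • f₂ :=
  Entire.ext fun _ => rfl

theorem sndAux_prod (Q : Entire ι₂ →L[ℂ] Entire ι₂) (f₁ : Entire ι₁) (f₂ : Entire ι₂) :
    sndAux Q (Entire.prod f₁ f₂) = (Entire.prod f₁ (Q f₂)).1 :=
  ContinuousMap.ext fun z => by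
    change (Q ((Entire.prod f₁ f₂).slice _)).1 _ = _
    rw [slice_prod, map_smul]
    rfl

/-- Holomorphy in the first group is clear on product functions. It passes to all f because the
entire functions are closed among the continuous ones. -/
theorem sndAux_mem (Q : Entire ι₂ →L[ℂ] Entire ι₂) (f : Entire (ι₁ ⊕ ι₂)) :
    sndAux Q f ∈ entireSubmodule (ι₁ ⊕ ι₂) := by
  refine Entire.mem_of_prod_mem (S := (entireSubmodule (ι₁ ⊕ ι₂)).comap
    (sndAux (ι₁ := ι₁) Q).toLinearMap)
    (isClosed_entireSubmodule.preimage (sndAux Q).cont) (fun f₁ f₂ => ?_) f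
  change sndAux Q (Entire.prod f₁ f₂) ∈ entireSubmodule (ι₁ ⊕ ι₂)
  rw [sndAux_prod]
  exact Subtype.prop _

/-- `1 ⊗ Q`: the operator `Q` applied in the second group of variables. -/
def sndCLM (Q : Entire ι₂ →L[ℂ] Entire ι₂) : Entire (ι₁ ⊕ ι₂) →L[ℂ] Entire (ι₁ ⊕ ι₂) :=
  (sndAux Q).codRestrict _ (sndAux_mem Q)

theorem sndCLM_prod (Q : Entire ι₂ →L[ℂ] Entire ι₂) (f₁ : Entire ι₁) (f₂ : Entire ι₂) :
    sndCLM Q (Entire.prod f₁ f₂) = Entire.prod f₁ (Q f₂) :=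
  Subtype.ext (sndAux_prod Q f₁ f₂)

/-- The operator `P ⊗ Q`. -/
def tensorCLM (P : Entire ι₁ →L[ℂ] Entire ι₁) (Q : Entire ι₂ →L[ℂ] Entire ι₂) :
    Entire (ι₁ ⊕ ι₂) →L[ℂ] Entire (ι₁ ⊕ ι₂) :=
  Entire.swap.comp ((sndCLM P).comp (Entire.swap.comp (sndCLM Q)))

theorem tensorCLM_prod (P : Entire ι₁ →L[ℂ] Entire ι₁) (Q : Entire ι₂ →L[ℂ] Entire ι₂)
    (f₁ : Entire ι₁) (f₂ : Entire ι₂) :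
    tensorCLM P Q (Entire.prod f₁ f₂) = Entire.prod (P f₁) (Q f₂) := by
  simp only [tensorCLM, ContinuousLinearMap.comp_apply, sndCLM_prod, Entire.swap_prod]

/-- The function `w ↦ Q(f(w, ·))(z)`. -/
def partialApply (Q : Entire ι₂ →L[ℂ] Entire ι₂) (f : Entire (ι₁ ⊕ ι₂)) (z : ι₂ → ℂ) : Entire ι₁ :=
  (Entire.swap (sndCLM Q f)).slice z

/-- Reading P ⊗ Q as two successive one-factor operators is what allows the one-factor estimates to
be applied in turn. -/
theorem tensorCLM_apply (P : Entire ι₁ →L[ℂ] Entire ι₁) (Q : Entire ι₂ →L[ℂ] Entire ι₂)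
    (f : Entire (ι₁ ⊕ ι₂)) (z : ι₁ ⊕ ι₂ → ℂ) :
    (tensorCLM P Q f).1 z
      = (P (partialApply Q f fun j => z (Sum.inr j))).1 (fun i => z (Sum.inl i)) := rfl

/-- The continuous linear form `μ ⊗ ν`. -/
def tensorForm (μ : EntireDual ι₁) (ν : EntireDual ι₂) : EntireDual (ι₁ ⊕ ι₂) :=
  -- The two rank-one operators take constant values, so the point of evaluation is immaterial.
  (Entire.evalCLM 0).comp (tensorCLM (μ.smulRight (polyEntire 1)) (ν.smulRight (polyEntire 1)))

theorem tensorForm_prod (μ : EntireDual ι₁) (ν : EntireDual ι₂) (f₁ : Entire ι₁) (f₂ : Entire ι₂) :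
    tensorForm μ ν (Entire.prod f₁ f₂) = μ f₁ * ν f₂ := by
  simp only [tensorForm, ContinuousLinearMap.comp_apply, tensorCLM_prod, Entire.evalCLM_apply]
  change (μ f₁ * MvPolynomial.eval (0 : ι₁ → ℂ) 1) * (ν f₂ * MvPolynomial.eval (0 : ι₂ → ℂ) 1) = _
  simp

theorem isTensor_iff {μ : EntireDual ι₁} {ν : EntireDual ι₂} {l : EntireDual (ι₁ ⊕ ι₂)} :
    IsTensor μ ν l ↔ l = tensorForm μ ν :=
  ⟨fun h => ext_of_prod fun f₁ f₂ => by rw [h, tensorForm_prod],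
    fun h f₁ f₂ => by rw [h, tensorForm_prod]⟩

/-- The bilinear map `(μ, ν) ↦ μ ⊗ ν`. -/
def tensorBilin (ι₁ ι₂ : Type) [Fintype ι₁] [Fintype ι₂] :
    EntireDual ι₁ →ₗ[ℂ] EntireDual ι₂ →ₗ[ℂ] EntireDual (ι₁ ⊕ ι₂) :=
  LinearMap.mk₂ ℂ tensorForm
    (fun μ μ' ν => ext_of_prod fun f₁ f₂ => by
      simp only [tensorForm_prod, _root_.add_apply, add_mul])
    (fun c μ ν => ext_of_prod fun f₁ f₂ => by
      simp only [tensorForm_prod, _root_.smul_apply, smul_eq_mul, mul_assoc])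
    (fun μ ν ν' => ext_of_prod fun f₁ f₂ => by
      simp only [tensorForm_prod, _root_.add_apply, mul_add])
    (fun c μ ν => ext_of_prod fun f₁ f₂ => by
      simp only [tensorForm_prod, _root_.smul_apply, smul_eq_mul, mul_left_comm])

theorem tensorForm_mem_tensorSpace {J₁ : Submodule ℂ (EntireDual ι₁)}
    {J₂ : Submodule ℂ (EntireDual ι₂)} {μ : EntireDual ι₁} {ν : EntireDual ι₂} (hμ : μ ∈ J₁)
    (hν : ν ∈ J₂) : tensorForm μ ν ∈ tensorSpace J₁ J₂ :=
  Submodule.subset_span ⟨μ, hμ, ν, hν, isTensor_iff.2 rfl⟩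

theorem tensorSpace_le {J₁ : Submodule ℂ (EntireDual ι₁)} {J₂ : Submodule ℂ (EntireDual ι₂)}
    {S : Submodule ℂ (EntireDual (ι₁ ⊕ ι₂))}
    (h : ∀ μ ∈ J₁, ∀ ν ∈ J₂, tensorForm μ ν ∈ S) : tensorSpace J₁ J₂ ≤ S := by
  refine Submodule.span_le.2 ?_
  rintro l ⟨μ, hμ, ν, hν, hl⟩
  rw [isTensor_iff.1 hl]
  exact h μ hμ ν hν

end Tensor

/-! ### Polynomial projectors -/

section Projectors

variable {ι : Type} [Fintype ι]

theorem IsPolyProjector.idem {d : ℕ} {P : Entire ι →L[ℂ] Entire ι} (hP : IsPolyProjector d P)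
    (f : Entire ι) : P (P f) = P f :=
  hP.fixes _ (hP.maps_to f)

/-- For any form μ, μ ∘ P is an interpolation condition of P, hence of Q, and forms separate points.
-/
theorem IsPolyProjector.apply_apply {d : ℕ} {P Q : Entire ι →L[ℂ] Entire ι}
    (hP : IsPolyProjector d P) (h : interpSpace P ≤ interpSpace Q) (f : Entire ι) :
    P (Q f) = P f := by
  refine Entire.eq_of_forall_dual fun μ => ?_
  have h1 : μ.comp P ∈ interpSpace P := fun g => by
    simp only [ContinuousLinearMap.comp_apply, hP.idem]
  exact (h h1 f).symm

/-- A polynomial projector is determined by its space of interpolation conditions. -/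
theorem IsPolyProjector.eq_of_interpSpace_eq {d : ℕ} {P Q : Entire ι →L[ℂ] Entire ι}
    (hP : IsPolyProjector d P) (hQ : IsPolyProjector d Q) (h : interpSpace P = interpSpace Q) :
    P = Q :=
  ContinuousLinearMap.ext fun f => by
    rw [← hP.apply_apply h.le, hP.fixes _ (hQ.maps_to f)]

namespace NewtonSequence

theorem ext' {𝒩 𝒩' : NewtonSequence ι} (h : ∀ d, 𝒩.proj d = 𝒩'.proj d) : 𝒩 = 𝒩' := by
  cases 𝒩
  cases 𝒩'
  congr
  exact funext h

variable (𝒩 : NewtonSequence ι)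

theorem interpSpace_mono : Monotone fun d => interpSpace (𝒩.proj d) :=
  monotone_nat_of_le_succ 𝒩.nested

theorem proj_proj_of_le {d e : ℕ} (h : d ≤ e) (f : Entire ι) :
    𝒩.proj d (𝒩.proj e f) = 𝒩.proj d f :=
  (𝒩.isPolyProjector d).apply_apply (𝒩.interpSpace_mono h) f

/-- The `d`-th Newton summand `Π_d - Π_{d-1}`. -/
def summand : ℕ → (Entire ι →L[ℂ] Entire ι)
  | 0 => 𝒩.proj 0
  | d + 1 => 𝒩.proj (d + 1) - 𝒩.proj d

theorem sum_summand (d : ℕ) : ∑ i ∈ Finset.range (d + 1), 𝒩.summand i = 𝒩.proj d := by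
  induction d with
  | zero => simp [summand]
  | succ d ih => rw [Finset.sum_range_succ, ih, summand, add_sub_cancel]

theorem sum_summand_apply (d : ℕ) (f : Entire ι) :
    ∑ i ∈ Finset.range (d + 1), 𝒩.summand i f = 𝒩.proj d f := by
  rw [← 𝒩.sum_summand d, _root_.sum_apply]

theorem isPolyDegreeLE_summand (d : ℕ) (f : Entire ι) : IsPolyDegreeLE d (𝒩.summand d f) := by
  cases d with
  | zero => exact (𝒩.isPolyProjector 0).maps_to f
  | succ d =>
    rw [← mem_polySubmodule]
    exact Submodule.sub_mem _ (mem_polySubmodule.2 ((𝒩.isPolyProjector (d + 1)).maps_to f))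
      (mem_polySubmodule.2 (((𝒩.isPolyProjector d).maps_to f).mono d.le_succ))

theorem summand_proj {a d : ℕ} (h : a ≤ d) (f : Entire ι) :
    𝒩.summand a (𝒩.proj d f) = 𝒩.summand a f := by
  cases a with
  | zero => exact 𝒩.proj_proj_of_le h f
  | succ a =>
    simp only [summand, _root_.sub_apply, 𝒩.proj_proj_of_le h, 𝒩.proj_proj_of_le (a.le_succ.trans h)]

theorem proj_summand {a d : ℕ} (h : a ≤ d) (f : Entire ι) :
    𝒩.proj d (𝒩.summand a f) = 𝒩.summand a f :=
  (𝒩.isPolyProjector d).fixes _ ((𝒩.isPolyDegreeLE_summand a f).mono h)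

theorem proj_summand_of_lt {a d : ℕ} (h : d < a) (f : Entire ι) :
    𝒩.proj d (𝒩.summand a f) = 0 := by
  cases a with
  | zero => exact absurd h (Nat.not_lt_zero _)
  | succ a =>
    simp only [summand, _root_.sub_apply, map_sub, 𝒩.proj_proj_of_le h.le,
      𝒩.proj_proj_of_le (Nat.lt_succ_iff.1 h), sub_self]

/-- The `a`-th Newton summand kills the polynomials of degree less than `a`. -/
theorem summand_eq_zero {a e : ℕ} (h : e < a) {f : Entire ι} (hf : IsPolyDegreeLE e f) :
    𝒩.summand a f = 0 := by
  cases a with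
  | zero => exact absurd h (Nat.not_lt_zero _)
  | succ a =>
    rw [summand, _root_.sub_apply, (𝒩.isPolyProjector _).fixes _ (hf.mono h.le),
      (𝒩.isPolyProjector _).fixes _ (hf.mono (Nat.lt_succ_iff.1 h)), sub_self]

/-- For a < b, the a-th summand factors through Π_a, which kills the b-th; for a > b, the values of
the b-th summand have too low a degree to survive. -/
theorem summand_summand_of_ne {a b : ℕ} (h : a ≠ b) (f : Entire ι) :
    𝒩.summand a (𝒩.summand b f) = 0 := by
  rcases h.lt_or_gt with h | h
  · rw [← 𝒩.summand_proj le_rfl, 𝒩.proj_summand_of_lt h, map_zero]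
  · exact 𝒩.summand_eq_zero h (𝒩.isPolyDegreeLE_summand b f)

theorem summand_summand (a : ℕ) (f : Entire ι) :
    𝒩.summand a (𝒩.summand a f) = 𝒩.summand a f := by
  have h := 𝒩.sum_summand_apply a (𝒩.summand a f)
  rw [𝒩.proj_summand le_rfl, Finset.sum_eq_single a
    (fun b _ hb => 𝒩.summand_summand_of_ne hb f) (by simp)] at h
  exact h

/-- The canonical Newton structure, made of the ranges of the transposes of the Newton summands. -/
def summandSpace (a : ℕ) : Submodule ℂ (EntireDual ι) where
  carrier := {μ | ∀ f, μ (𝒩.summand a f) = μ f}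
  add_mem' := fun {μ ν} hμ hν f => by simp only [_root_.add_apply, hμ f, hν f]
  zero_mem' := fun f => by simp
  smul_mem' := fun c ν hν f => by simp only [_root_.smul_apply, hν f]

theorem isNewtonStructure_summandSpace : 𝒩.IsNewtonStructure 𝒩.summandSpace := by
  refine ⟨fun a => ?_, fun d => le_antisymm (fun μ hμ => ?_) (iSup₂_le fun a ha μ hμ f => ?_)⟩
  · rw [Submodule.disjoint_def]
    intro μ hμ hμ'
    -- The annihilator of the range of the a-th summand: it contains all other spaces of the
    -- structure and meets the a-th one only in 0.
    let S : Submodule ℂ (EntireDual ι) :=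
      { carrier := {ν | ∀ f, ν (𝒩.summand a f) = 0}
        add_mem' := fun {μ ν} hμ hν f => by simp only [_root_.add_apply, hμ f, hν f, add_zero]
        zero_mem' := fun f => by simp
        smul_mem' := fun c ν hν f => by simp only [_root_.smul_apply, hν f, smul_zero] }
    have hS : ⨆ (b : ℕ) (_ : b ≠ a), 𝒩.summandSpace b ≤ S :=
      iSup₂_le fun b hb ν hν f => by rw [← hν, 𝒩.summand_summand_of_ne hb, map_zero]
    exact ContinuousLinearMap.ext fun f => by rw [← hμ f, hS hμ' f]; rfl
  · have e : μ = ∑ a ∈ Finset.range (d + 1), μ.comp (𝒩.summand a) :=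
      ContinuousLinearMap.ext fun f => by
        rw [hμ f, ← 𝒩.sum_summand_apply, map_sum, _root_.sum_apply]
        rfl
    rw [e]
    refine Submodule.sum_mem _ fun a ha => ?_
    refine Submodule.mem_iSup_of_mem a (Submodule.mem_iSup_of_mem
      (Nat.lt_succ_iff.1 (Finset.mem_range.1 ha)) fun f => ?_)
    simp only [ContinuousLinearMap.comp_apply, 𝒩.summand_summand]
  · rw [← hμ f, ← hμ (𝒩.proj d f), 𝒩.summand_proj ha]

end NewtonSequence

/-- An operator with polynomial values of bounded degree has finite rank. -/
theorem exists_finite_rank {d : ℕ} {P : Entire ι →L[ℂ] Entire ι}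
    (hP : ∀ f, IsPolyDegreeLE d (P f)) :
    ∃ (n : ℕ) (c : Fin n → EntireDual ι) (m : Fin n → Entire ι),
      (∀ k, IsPolyDegreeLE d (m k)) ∧ (∀ f, P f = ∑ k, c k f • m k) ∧
      ∀ f g, P f = P g → ∀ k, c k f = c k g := by
  let V : Submodule ℂ C(ι → ℂ, ℂ) :=
    (MvPolynomial.restrictTotalDegree ι ℂ d).map ((entireSubmodule ι).subtype.comp polyEntire)
  have hV : ∀ f, ((entireSubmodule ι).subtypeL.comp P) f ∈ V := fun f => by
    obtain ⟨p, hp, h⟩ := isPolyDegreeLE_iff.1 (hP f)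
    refine Submodule.mem_map.2 ⟨p, (MvPolynomial.mem_restrictTotalDegree ..).2 hp, ?_⟩
    change (polyEntire p).1 = (P f).1
    rw [h]
  have hVm : ∀ v : V, ∃ g : Entire ι, IsPolyDegreeLE d g ∧ g.1 = v := fun v => by
    obtain ⟨p, hp, h⟩ := Submodule.mem_map.1 v.2
    exact ⟨polyEntire p, isPolyDegreeLE_iff.2 ⟨p, (MvPolynomial.mem_restrictTotalDegree ..).1 hp,
      rfl⟩, h⟩
  choose m hm hmv using hVm
  let P' : Entire ι →L[ℂ] V := ((entireSubmodule ι).subtypeL.comp P).codRestrict V hV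
  let b := Module.finBasis ℂ V
  -- The coefficient forms are coordinates of P f, so they depend on f only through P f. This later
  -- places them in the interpolation spaces.
  refine ⟨_, fun k => (LinearMap.toContinuousLinearMap (b.coord k)).comp P', fun k => m (b k),
    fun k => hm _, fun f => Subtype.ext ?_, fun f g h k => ?_⟩
  · have h := congrArg Subtype.val (b.sum_repr (P' f))
    have e : ((P' f : V) : C(ι → ℂ, ℂ)) = (P f).1 := rfl
    rw [← e, ← h]
    simp only [AddSubmonoidClass.coe_finsetSum, Submodule.coe_smul, hmv]
    rfl
  · have : P' f = P' g := Subtype.ext (congrArg (fun x : Entire ι => x.1) h)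
    simp only [ContinuousLinearMap.comp_apply, this]

end Projectors

/-! ### Newton products -/

section Products

variable {ι₁ ι₂ : Type} [Fintype ι₁] [Fintype ι₂]

theorem IsPolyDegreeLE.prod {d e : ℕ} {f : Entire ι₁} {g : Entire ι₂} (hf : IsPolyDegreeLE d f)
    (hg : IsPolyDegreeLE e g) : IsPolyDegreeLE (d + e) (Entire.prod f g) := by
  obtain ⟨p, hp, hf⟩ := hf
  obtain ⟨q, hq, hg⟩ := hg
  refine ⟨MvPolynomial.rename Sum.inl p * MvPolynomial.rename Sum.inr q, ?_, fun z => ?_⟩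
  · exact (MvPolynomial.totalDegree_mul _ _).trans (add_le_add
      ((MvPolynomial.totalDegree_rename_le _ _).trans hp)
      ((MvPolynomial.totalDegree_rename_le _ _).trans hq))
  · rw [map_mul, MvPolynomial.eval_rename, MvPolynomial.eval_rename]
    change f.1 _ * g.1 _ = _
    rw [hf, hg]
    rfl

/-- The pairs `(i, j)` with `i + j ≤ d`. -/
def simplexPairs (d : ℕ) : Finset (ℕ × ℕ) :=
  (Finset.range (d + 1) ×ˢ Finset.range (d + 1)).filter fun p => p.1 + p.2 ≤ d

theorem mem_simplexPairs {d : ℕ} {p : ℕ × ℕ} : p ∈ simplexPairs d ↔ p.1 + p.2 ≤ d := by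
  simp only [simplexPairs, Finset.mem_filter, Finset.mem_product, Finset.mem_range]
  omega

variable (𝒩₁ : NewtonSequence ι₁) (𝒩₂ : NewtonSequence ι₂)

/-- The `d`-th projector of the Newton product. -/
def productProj (d : ℕ) : Entire (ι₁ ⊕ ι₂) →L[ℂ] Entire (ι₁ ⊕ ι₂) :=
  ∑ p ∈ simplexPairs d, tensorCLM (𝒩₁.summand p.1) (𝒩₂.summand p.2)

theorem productProj_apply (d : ℕ) (f : Entire (ι₁ ⊕ ι₂)) :
    productProj 𝒩₁ 𝒩₂ d f
      = ∑ p ∈ simplexPairs d, tensorCLM (𝒩₁.summand p.1) (𝒩₂.summand p.2) f := by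
  rw [productProj, _root_.sum_apply]

theorem sum_product_summand (i j : ℕ) (f₁ : Entire ι₁) (f₂ : Entire ι₂) :
    ∑ p ∈ Finset.range (i + 1) ×ˢ Finset.range (j + 1),
      Entire.prod (𝒩₁.summand p.1 f₁) (𝒩₂.summand p.2 f₂)
      = Entire.prod (𝒩₁.proj i f₁) (𝒩₂.proj j f₂) := by
  refine Entire.ext fun z => ?_
  simp only [← Entire.evalCLM_apply, map_sum]
  have e : ∀ (g₁ : Entire ι₁) (g₂ : Entire ι₂), Entire.evalCLM z (Entire.prod g₁ g₂)
    = Entire.evalCLM (fun i => z (Sum.inl i)) g₁ * Entire.evalCLM (fun i => z (Sum.inr i)) g₂ :=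
    fun _ _ => rfl
  simp only [e]
  rw [← 𝒩₁.sum_summand_apply, ← 𝒩₂.sum_summand_apply, map_sum, map_sum, Finset.sum_mul_sum,
    Finset.sum_product]

/-- On f₁ ⊗ f₂ only summands in the rectangle [0,i] × [0,j] contribute, since μ = μ ∘ Π_i and ν = ν
∘ Π_j kill the later ones. The rectangle lies in the simplex, and its sum telescopes to Π_i ⊗ Π_j.
-/
theorem tensorForm_productProj {d i j : ℕ} (h : i + j ≤ d) {μ : EntireDual ι₁} {ν : EntireDual ι₂}
    (hμ : μ ∈ interpSpace (𝒩₁.proj i)) (hν : ν ∈ interpSpace (𝒩₂.proj j)) :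
    (tensorForm μ ν).comp (productProj 𝒩₁ 𝒩₂ d) = tensorForm μ ν := by
  refine ext_of_prod fun f₁ f₂ => ?_
  rw [ContinuousLinearMap.comp_apply, productProj_apply, map_sum]
  simp only [tensorCLM_prod]
  rw [← Finset.sum_subset (s₁ := Finset.range (i + 1) ×ˢ Finset.range (j + 1)), ← map_sum,
    sum_product_summand, tensorForm_prod, tensorForm_prod, ← hμ, ← hν]
  · intro p hp
    simp only [Finset.mem_product, Finset.mem_range] at hp
    rw [mem_simplexPairs]
    omega
  · intro p _ hp
    rw [tensorForm_prod, hμ, hν]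
    simp only [Finset.mem_product, Finset.mem_range, not_and_or, not_lt] at hp
    rcases hp with hp | hp
    · rw [𝒩₁.proj_summand_of_lt (by omega), map_zero, zero_mul]
    · rw [𝒩₂.proj_summand_of_lt (by omega), map_zero, mul_zero]

/-- The same rectangle argument; outside the rectangle a summand now vanishes because its index
exceeds the degree of its argument. -/
theorem productProj_prod_poly {d i j : ℕ} (h : i + j ≤ d) {f₁ : Entire ι₁} {f₂ : Entire ι₂}
    (hf₁ : IsPolyDegreeLE i f₁) (hf₂ : IsPolyDegreeLE j f₂) :
    productProj 𝒩₁ 𝒩₂ d (Entire.prod f₁ f₂) = Entire.prod f₁ f₂ := by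
  rw [productProj_apply]
  simp only [tensorCLM_prod]
  rw [← Finset.sum_subset (s₁ := Finset.range (i + 1) ×ˢ Finset.range (j + 1)),
    sum_product_summand, (𝒩₁.isPolyProjector i).fixes _ hf₁, (𝒩₂.isPolyProjector j).fixes _ hf₂]
  · intro p hp
    simp only [Finset.mem_product, Finset.mem_range] at hp
    rw [mem_simplexPairs]
    omega
  · intro p _ hp
    refine Entire.ext fun z => ?_
    change (𝒩₁.summand p.1 f₁).1 _ * (𝒩₂.summand p.2 f₂).1 _ = 0
    simp only [Finset.mem_product, Finset.mem_range, not_and_or, not_lt] at hp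
    rcases hp with hp | hp
    · rw [𝒩₁.summand_eq_zero (by omega) hf₁]
      exact zero_mul _
    · rw [𝒩₂.summand_eq_zero (by omega) hf₂]
      exact mul_zero _

theorem tensorCLM_finite_rank {P : Entire ι₁ →L[ℂ] Entire ι₁} {Q : Entire ι₂ →L[ℂ] Entire ι₂}
    {n n' : ℕ} {c : Fin n → EntireDual ι₁} {m : Fin n → Entire ι₁} {c' : Fin n' → EntireDual ι₂}
    {m' : Fin n' → Entire ι₂} (hP : ∀ f, P f = ∑ k, c k f • m k)
    (hQ : ∀ f, Q f = ∑ k, c' k f • m' k) :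
    tensorCLM P Q = ∑ k, ∑ l, (tensorForm (c k) (c' l)).smulRight (Entire.prod (m k) (m' l)) := by
  refine ext_of_prod fun f₁ f₂ => Entire.ext fun z => ?_
  rw [tensorCLM_prod, hP, hQ]
  have e : ∀ (g₁ : Entire ι₁) (g₂ : Entire ι₂), Entire.evalCLM z (Entire.prod g₁ g₂)
    = Entire.evalCLM (fun i => z (Sum.inl i)) g₁ * Entire.evalCLM (fun i => z (Sum.inr i)) g₂ :=
    fun _ _ => rfl
  rw [← Entire.evalCLM_apply, ← Entire.evalCLM_apply, e]
  simp only [_root_.sum_apply, map_sum, ContinuousLinearMap.smulRight_apply, map_smul,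
    tensorForm_prod, e, smul_eq_mul, Finset.sum_mul_sum]
  exact Finset.sum_congr rfl fun _ _ => Finset.sum_congr rfl fun _ _ => by ring

theorem isPolyProjector_productProj (d : ℕ) : IsPolyProjector d (productProj 𝒩₁ 𝒩₂ d) where
  maps_to f := by
    rw [productProj_apply, ← mem_polySubmodule]
    refine Submodule.sum_mem _ fun p hp => ?_
    obtain ⟨n, c, m, hm, hc, -⟩ := exists_finite_rank (𝒩₁.isPolyDegreeLE_summand p.1)
    obtain ⟨n', c', m', hm', hc', -⟩ := exists_finite_rank (𝒩₂.isPolyDegreeLE_summand p.2)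
    rw [tensorCLM_finite_rank hc hc', _root_.sum_apply]
    refine Submodule.sum_mem _ fun k _ => ?_
    rw [_root_.sum_apply]
    refine Submodule.sum_mem _ fun l _ => ?_
    rw [ContinuousLinearMap.smulRight_apply]
    exact Submodule.smul_mem _ _ (mem_polySubmodule.2
      (((hm k).prod (hm' l)).mono (mem_simplexPairs.1 hp)))
  fixes f hf := by
    obtain ⟨p, hp, rfl⟩ := isPolyDegreeLE_iff.1 hf
    exact polyEntire_mem_of_prod_mem
      (S := LinearMap.eqLocus (productProj 𝒩₁ 𝒩₂ d).toLinearMap LinearMap.id)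
      (fun q₁ q₂ hq => productProj_prod_poly 𝒩₁ 𝒩₂ hq (isPolyDegreeLE_iff.2 ⟨q₁, le_rfl, rfl⟩)
        (isPolyDegreeLE_iff.2 ⟨q₂, le_rfl, rfl⟩)) hp

/-- The space of interpolation conditions of the Newton product. -/
theorem interpSpace_productProj (d : ℕ) : interpSpace (productProj 𝒩₁ 𝒩₂ d) =
    ⨆ (i : ℕ) (j : ℕ) (_ : i + j ≤ d),
      tensorSpace (interpSpace (𝒩₁.proj i)) (interpSpace (𝒩₂.proj j)) := by
  refine le_antisymm (fun l hl => ?_) (iSup_le fun i => iSup₂_le fun j h =>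
    tensorSpace_le fun μ hμ ν hν f => ?_)
  · have e : l = ∑ p ∈ simplexPairs d, l.comp (tensorCLM (𝒩₁.summand p.1) (𝒩₂.summand p.2)) :=
      ContinuousLinearMap.ext fun f => by
        rw [hl f, productProj_apply, map_sum, _root_.sum_apply]
        rfl
    rw [e]
    refine Submodule.sum_mem _ fun p hp => Submodule.mem_iSup_of_mem p.1
      (Submodule.mem_iSup_of_mem p.2 (Submodule.mem_iSup_of_mem (mem_simplexPairs.1 hp) ?_))
    obtain ⟨n, c, m, -, hc, hcc⟩ := exists_finite_rank (𝒩₁.isPolyDegreeLE_summand p.1)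
    obtain ⟨n', c', m', -, hc', hcc'⟩ := exists_finite_rank (𝒩₂.isPolyDegreeLE_summand p.2)
    have e' : l.comp (tensorCLM (𝒩₁.summand p.1) (𝒩₂.summand p.2))
        = ∑ k, ∑ k', l (Entire.prod (m k) (m' k')) • tensorForm (c k) (c' k') :=
      ContinuousLinearMap.ext fun f => by
        rw [tensorCLM_finite_rank hc hc']
        simp only [ContinuousLinearMap.comp_apply, _root_.sum_apply, map_sum,
          ContinuousLinearMap.smulRight_apply, map_smul, _root_.smul_apply, smul_eq_mul, mul_comm]
    rw [e']
    refine Submodule.sum_mem _ fun k _ => Submodule.sum_mem _ fun k' _ => Submodule.smul_mem _ _ ?_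
    -- The i-th summand is unchanged by precomposition with Π_i, so its coefficient forms are
    -- conditions of Π_i.
    exact tensorForm_mem_tensorSpace
      (fun f => (hcc _ _ (𝒩₁.summand_proj le_rfl f) k).symm)
      (fun f => (hcc' _ _ (𝒩₂.summand_proj le_rfl f) k').symm)
  · conv_lhs => rw [← tensorForm_productProj 𝒩₁ 𝒩₂ h hμ hν]
    rfl

/-- The Newton product as a Newton sequence. -/
def newtonProduct : NewtonSequence (ι₁ ⊕ ι₂) where
  proj := productProj 𝒩₁ 𝒩₂
  isPolyProjector := isPolyProjector_productProj 𝒩₁ 𝒩₂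
  nested d := by
    rw [interpSpace_productProj, interpSpace_productProj]
    exact iSup_mono fun i => iSup_mono fun j => iSup_le fun h => le_iSup_of_le (by omega) le_rfl

variable {𝒩₁ 𝒩₂}

/-- The space of interpolation conditions does not depend on the Newton structures. -/
theorem iSup_tensorSpace_newtonStructure {J₁ : ℕ → Submodule ℂ (EntireDual ι₁)}
    {J₂ : ℕ → Submodule ℂ (EntireDual ι₂)} (h₁ : 𝒩₁.IsNewtonStructure J₁)
    (h₂ : 𝒩₂.IsNewtonStructure J₂) (d : ℕ) :
    ⨆ (i : ℕ) (j : ℕ) (_ : i + j ≤ d), tensorSpace (J₁ i) (J₂ j)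
      = interpSpace (productProj 𝒩₁ 𝒩₂ d) := by
  rw [interpSpace_productProj]
  refine le_antisymm (iSup_mono fun i => iSup_mono fun j => iSup_mono fun _ =>
    tensorSpace_le fun μ hμ ν hν => tensorForm_mem_tensorSpace ?_ ?_)
    (iSup_le fun i => iSup₂_le fun j h => tensorSpace_le fun μ hμ ν hν => ?_)
  · rw [h₁.2]
    exact Submodule.mem_iSup_of_mem i (Submodule.mem_iSup_of_mem le_rfl hμ)
  · rw [h₂.2]
    exact Submodule.mem_iSup_of_mem j (Submodule.mem_iSup_of_mem le_rfl hν)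
  · set S := ⨆ (i : ℕ) (j : ℕ) (_ : i + j ≤ d), tensorSpace (J₁ i) (J₂ j)
    -- Expanding μ and ν along the structures gives indices a ≤ i, b ≤ j, which stay in the simplex;
    -- bilinearity is then used one variable at a time.
    have key : ∀ a ≤ i, ∀ b ≤ j, ∀ μ ∈ J₁ a, ∀ ν ∈ J₂ b, tensorForm μ ν ∈ S :=
      fun a ha b hb μ hμ ν hν => Submodule.mem_iSup_of_mem a (Submodule.mem_iSup_of_mem b
        (Submodule.mem_iSup_of_mem ((add_le_add ha hb).trans h)
          (tensorForm_mem_tensorSpace hμ hν)))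
    have step : ∀ a ≤ i, ∀ μ ∈ J₁ a, ∀ ν ∈ interpSpace (𝒩₂.proj j), tensorForm μ ν ∈ S := by
      intro a ha μ hμ
      have : interpSpace (𝒩₂.proj j) ≤ S.comap (tensorBilin ι₁ ι₂ μ) := by
        rw [h₂.2]
        exact iSup₂_le fun b hb ν hν => key a ha b hb μ hμ ν hν
      exact this
    have : interpSpace (𝒩₁.proj i) ≤ S.comap ((tensorBilin ι₁ ι₂).flip ν) := by
      rw [h₁.2]
      exact iSup₂_le fun a ha μ hμ => step a ha μ hμ ν hν
    exact this hμ

theorem isNewtonProduct_newtonProduct : IsNewtonProduct 𝒩₁ 𝒩₂ (newtonProduct 𝒩₁ 𝒩₂) :=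
  ⟨_, _, 𝒩₁.isNewtonStructure_summandSpace, 𝒩₂.isNewtonStructure_summandSpace, fun d =>
    (iSup_tensorSpace_newtonStructure 𝒩₁.isNewtonStructure_summandSpace
      𝒩₂.isNewtonStructure_summandSpace d).symm⟩

theorem IsNewtonProduct.eq_newtonProduct {𝒩 : NewtonSequence (ι₁ ⊕ ι₂)}
    (h : IsNewtonProduct 𝒩₁ 𝒩₂ 𝒩) : 𝒩 = newtonProduct 𝒩₁ 𝒩₂ := by
  obtain ⟨J₁, J₂, h₁, h₂, h⟩ := h
  refine NewtonSequence.ext' fun d => (𝒩.isPolyProjector d).eq_of_interpSpace_eq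
    (isPolyProjector_productProj 𝒩₁ 𝒩₂ d) ((h d).trans ?_)
  exact iSup_tensorSpace_newtonStructure h₁ h₂ d

end Products

/-! ### Norms and growth -/

section Growth

variable {ι : Type} [Fintype ι]

theorem PCNorm.continuous (N : PCNorm ι) : Continuous N.toSeminorm := by
  classical
  have hb : ∀ v : ι → ℂ, N.toSeminorm v ≤ (∑ i, N.toSeminorm (Pi.single i 1)) * ‖v‖ := fun v => by
    have e : v = ∑ i, v i • Pi.single i (1 : ℂ) := by
      ext j
      simp [Finset.sum_apply, Pi.single_apply]
    conv_lhs => rw [e]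
    refine (Finset.le_sum_of_subadditive N.toSeminorm (map_zero _).le (map_add_le_add _) _ _).trans ?_
    rw [Finset.sum_mul]
    refine Finset.sum_le_sum fun i _ => ?_
    rw [map_smul_eq_mul, mul_comm]
    exact mul_le_mul_of_nonneg_left (norm_le_pi_norm v i) (apply_nonneg _ _)
  have h0 : 0 ≤ ∑ i, N.toSeminorm (Pi.single i 1) := Finset.sum_nonneg fun i _ => apply_nonneg _ _
  refine (LipschitzWith.of_le_add_mul ⟨_, h0⟩ fun x y => ?_).continuous
  have h := map_add_le_add N.toSeminorm y (x - y)
  rw [add_sub_cancel] at h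
  rw [dist_eq_norm]
  exact h.trans (add_le_add_right (hb _) _)

theorem PCNorm.exists_norm_le (N : PCNorm ι) : ∃ C : ℝ, ∀ z, ‖z‖ ≤ C * N.toSeminorm z := by
  have key : ∀ z : ι → ℂ, z ≠ 0 → ((‖z‖⁻¹ : ℝ) : ℂ) • z ∈ Metric.sphere (0 : ι → ℂ) 1 :=
    fun z hz => by
      rw [mem_sphere_zero_iff_norm, norm_smul, Complex.norm_real, norm_inv, norm_norm,
        inv_mul_cancel₀ (norm_ne_zero_iff.2 hz)]
  rcases (Metric.sphere (0 : ι → ℂ) 1).eq_empty_or_nonempty with h | h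
  · refine ⟨0, fun z => ?_⟩
    rcases eq_or_ne z 0 with rfl | hz
    · simp
    · exact absurd (h ▸ key z hz) (Set.notMem_empty _)
  · obtain ⟨x, hx, hmin⟩ := (isCompact_sphere (0 : ι → ℂ) 1).exists_isMinOn h
      N.continuous.continuousOn
    have hx0 : 0 < N.toSeminorm x := (apply_nonneg _ _).lt_of_ne fun h0 => by
      rw [N.eq_zero x h0.symm, mem_sphere_zero_iff_norm, norm_zero] at hx
      exact zero_ne_one hx
    refine ⟨(N.toSeminorm x)⁻¹, fun z => ?_⟩
    rcases eq_or_ne z 0 with rfl | hz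
    · simp
    have h1 : N.toSeminorm x ≤ N.toSeminorm (((‖z‖⁻¹ : ℝ) : ℂ) • z) := hmin (key z hz)
    rw [map_smul_eq_mul, Complex.norm_real, norm_inv, norm_norm, inv_mul_eq_div,
      le_div_iff₀ (norm_pos_iff.2 hz)] at h1
    rwa [inv_mul_eq_div, le_div_iff₀ hx0, mul_comm]

/-- Balls of N are compact, so the `sSup` is a genuine supremum and not the default value. -/
theorem norm_le_maxModulus (N : PCNorm ι) (f : Entire ι) {r : ℝ} {z : ι → ℂ}
    (hz : N.toSeminorm z ≤ r) : ‖f.1 z‖ ≤ maxModulus N f r := by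
  obtain ⟨C, hC⟩ := N.exists_norm_le
  have hb : Bornology.IsBounded {z | N.toSeminorm z ≤ r} :=
    isBounded_iff_forall_norm_le.2 ⟨|C| * r, fun z hz => (hC z).trans <|
      mul_le_mul (le_abs_self C) hz (apply_nonneg _ _) (abs_nonneg C)⟩
  have hK : IsCompact {z | N.toSeminorm z ≤ r} :=
    Metric.isCompact_of_isClosed_isBounded (isClosed_le N.continuous continuous_const) hb
  exact le_csSup (hK.image f.1.continuous.norm).bddAbove ⟨z, hz, rfl⟩

variable {ω : ℝ} {N : PCNorm ι}

/-- The growth bound `|f(z)| ≤ A exp(t N(z)^ω)`. -/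
def ExpBound (ω : ℝ) (N : PCNorm ι) (t A : ℝ) (f : Entire ι) : Prop :=
  ∀ z, ‖f.1 z‖ ≤ A * Real.exp (t * N.toSeminorm z ^ ω)

theorem ExpBound.nonneg {t A : ℝ} {f : Entire ι} (h : ExpBound ω N t A f) : 0 ≤ A :=
  nonneg_of_mul_nonneg_left ((norm_nonneg _).trans (h 0)) (Real.exp_pos _)

theorem exists_expBound_of_mem {τ : ℝ} (hτ : 0 < τ) {f : Entire ι}
    (hf : f ∈ entireOfTypeLT ω N τ) : ∃ t A, 0 < t ∧ t < τ ∧ ExpBound ω N t A f := by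
  obtain ⟨θ, hθ, hθτ⟩ := EReal.lt_iff_exists_real_btwn.1 (show omegaType ω N f < τ from hf)
  have hθτ' : θ < τ := EReal.coe_lt_coe_iff.1 hθτ
  have h := eventually_lt_of_limsup_lt (show limsup _ atTop < (θ : EReal) from hθ)
  obtain ⟨R, hR⟩ := eventually_atTop.1 (h.and (eventually_gt_atTop 0))
  have hR0 : 0 < R := (hR R le_rfl).2
  -- The number θ may be negative; the maximum is positive and still below τ.
  have ht : 0 < max θ (τ / 2) := lt_max_of_lt_right (half_pos hτ)
  set t := max θ (τ / 2)
  have key : ∀ r, R ≤ r → maxModulus N f r ≤ Real.exp (t * r ^ ω) := fun r hr => by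
    rcases le_or_gt (maxModulus N f r) 0 with h0 | h0
    · exact h0.trans (Real.exp_pos _).le
    · have hr0 : 0 < r := hR0.trans_le hr
      have h1 : Real.log (maxModulus N f r) / r ^ ω < θ := EReal.coe_lt_coe_iff.1 (hR r hr).1
      rw [div_lt_iff₀ (Real.rpow_pos_of_pos hr0 _)] at h1
      refine (Real.log_le_iff_le_exp h0).1 (h1.le.trans ?_)
      exact mul_le_mul_of_nonneg_right (le_max_left _ _) (Real.rpow_nonneg hr0.le _)
  -- The prefactor absorbs the ball of radius R, where the limsup gives no information.
  refine ⟨t, Real.exp (t * R ^ ω), ht, max_lt hθτ' (half_lt_self hτ), fun z => ?_⟩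
  have hz0 : 0 ≤ N.toSeminorm z := apply_nonneg _ _
  rcases le_total R (N.toSeminorm z) with h1 | h1
  · refine (norm_le_maxModulus N f le_rfl).trans ((key _ h1).trans ?_)
    exact le_mul_of_one_le_left (Real.exp_pos _).le
      (Real.one_le_exp (mul_nonneg ht.le (Real.rpow_nonneg hR0.le _)))
  · refine (norm_le_maxModulus N f h1).trans ((key _ le_rfl).trans ?_)
    exact le_mul_of_one_le_right (Real.exp_pos _).le
      (Real.one_le_exp (mul_nonneg ht.le (Real.rpow_nonneg hz0 _)))

theorem ExpBound.mem {t A τ : ℝ} (hω : 0 < ω) (ht : 0 ≤ t) (htτ : t < τ) {f : Entire ι}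
    (hf : ExpBound ω N t A f) : f ∈ entireOfTypeLT ω N τ := by
  -- With `max A 1` the logarithm is nonnegative, which also covers a vanishing modulus, where
  -- `Real.log` returns 0.
  have hlim : Tendsto (fun r : ℝ => Real.log (max A 1) / r ^ ω + t) atTop (𝓝 t) := by
    simpa using ((tendsto_rpow_atTop hω).const_div_atTop (Real.log (max A 1))).add_const t
  have hlim' : Tendsto (fun r : ℝ => ((Real.log (max A 1) / r ^ ω + t : ℝ) : EReal)) atTop
    (𝓝 (t : EReal)) := (continuous_coe_real_ereal.tendsto t).comp hlim
  have hle : omegaType ω N f ≤ (t : EReal) := by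
    rw [← hlim'.limsup_eq]
    refine limsup_le_limsup ?_
    filter_upwards [eventually_gt_atTop 0] with r hr
    have hrω : 0 < r ^ ω := Real.rpow_pos_of_pos hr _
    rw [EReal.coe_le_coe_iff, div_add' _ _ _ hrω.ne', div_le_div_iff_of_pos_right hrω]
    have hA : 0 < max A 1 := lt_max_of_lt_right one_pos
    have hM : maxModulus N f r ≤ max A 1 * Real.exp (t * r ^ ω) := by
      refine csSup_le ⟨_, 0, by simpa using hr.le, rfl⟩ ?_
      rintro _ ⟨z, hz, rfl⟩
      refine (hf z).trans (mul_le_mul (le_max_left _ _) (Real.exp_le_exp.2 ?_)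
        (Real.exp_pos _).le hA.le)
      exact mul_le_mul_of_nonneg_left (Real.rpow_le_rpow (apply_nonneg _ _) hz hω.le) ht
    have hM0 : 0 ≤ maxModulus N f r :=
      (norm_nonneg _).trans (norm_le_maxModulus N f (z := 0) (by simpa using hr.le))
    rcases hM0.eq_or_lt with h0 | h0
    · rw [← h0, Real.log_zero]
      exact add_nonneg (Real.log_nonneg (le_max_right _ _)) (mul_nonneg ht hrω.le)
    · refine (Real.log_le_log h0 hM).trans_eq ?_
      rw [Real.log_mul hA.ne' (Real.exp_pos _).ne', Real.log_exp]
  exact hle.trans_lt (EReal.coe_lt_coe_iff.2 htτ)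

end Growth

/-! ### Uniform boundedness on weighted spaces -/

section UniformBound

open scoped BoundedContinuousFunction

variable {ι : Type} [Fintype ι]

/-- Multiplication of bounded functions by a fixed continuous function. -/
def mulWeight (W : C(ι → ℂ, ℂ)) : ((ι → ℂ) →ᵇ ℂ) →L[ℂ] C(ι → ℂ, ℂ) where
  toFun g := W * g.toContinuousMap
  map_add' g h := ContinuousMap.ext fun z => mul_add (W z) (g z) (h z)
  map_smul' c g := ContinuousMap.ext fun z => mul_left_comm (W z) c (g z)
  cont := ContinuousMap.continuous_of_continuous_uncurry _ <|
    (W.continuous.comp continuous_snd).mul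
      (continuous_eval (F := (ι → ℂ) →ᵇ ℂ) (X := ι → ℂ) (Y := ℂ))

/-- The bounded functions `g` such that `W g` is entire. -/
def weightedEntire (W : C(ι → ℂ, ℂ)) : Submodule ℂ ((ι → ℂ) →ᵇ ℂ) :=
  (entireSubmodule ι).comap (mulWeight W).toLinearMap

/-- Closedness makes this a Banach space, as Banach–Steinhaus requires. -/
theorem isClosed_weightedEntire (W : C(ι → ℂ, ℂ)) :
    IsClosed (weightedEntire W : Set ((ι → ℂ) →ᵇ ℂ)) :=
  isClosed_entireSubmodule.preimage (mulWeight W).cont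

instance (W : C(ι → ℂ, ℂ)) : CompleteSpace (weightedEntire W) :=
  (isClosed_weightedEntire W).completeSpace_coe

/-- The map `g ↦ W g`. -/
def weightedEntire.toEntire (W : C(ι → ℂ, ℂ)) : weightedEntire W →L[ℂ] Entire ι :=
  ((mulWeight W).comp (weightedEntire W).subtypeL).codRestrict _ fun g => g.2

/-- A convergent sequence with its limit is compact, and evaluation is jointly continuous. -/
theorem exists_bound_of_tendsto {F : ℕ → Entire ι} {f : Entire ι} (hF : Tendsto F atTop (𝓝 f))
    {K : Set (ι → ℂ)} (hK : IsCompact K) : ∃ C, ∀ i, ∀ z ∈ K, ‖(F i).1 z‖ ≤ C := by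
  obtain ⟨C, hC⟩ := (hF.isCompact_insert_range.prod hK).exists_bound_of_continuousOn
    Entire.continuous_eval.continuousOn
  exact ⟨C, fun i z hz => hC (F i, z) ⟨Set.mem_insert_of_mem _ ⟨i, rfl⟩, hz⟩⟩

/-- The Banach–Steinhaus theorem on a space of entire functions with a growth condition. -/
theorem exists_uniform_bound {ω t : ℝ} (hω : 0 < ω) {N : PCNorm ι}
    {T : ℕ → (Entire ι →L[ℂ] Entire ι)}
    (hT : ∀ A f, ExpBound ω N t A f → ∃ g, Tendsto (fun i => T i f) atTop (𝓝 g))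
    {K : Set (ι → ℂ)} (hK : IsCompact K) :
    ∃ C, ∀ i A f, ExpBound ω N t A f → ∀ z ∈ K, ‖(T i f).1 z‖ ≤ C * A := by
  have hcw : Continuous fun z => Real.exp (t * N.toSeminorm z ^ ω) :=
    Real.continuous_exp.comp (continuous_const.mul (N.continuous.rpow_const fun _ => Or.inr hω.le))
  let W : C(ι → ℂ, ℂ) :=
    ⟨fun z => (Real.exp (t * N.toSeminorm z ^ ω) : ℂ), Complex.continuous_ofReal.comp hcw⟩
  have hW : ∀ z, ‖W z‖ = Real.exp (t * N.toSeminorm z ^ ω) := fun z =>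
    (Complex.norm_real _).trans (Real.norm_of_nonneg (Real.exp_pos _).le)
  let Φ : ℕ × K → (weightedEntire W →L[ℂ] ℂ) := fun p =>
    (Entire.evalCLM p.2.1).comp ((T p.1).comp (weightedEntire.toEntire W))
  have hΦ : ∀ g, ∃ C, ∀ p, ‖Φ p g‖ ≤ C := fun g => by
    obtain ⟨h, hh⟩ := hT ‖g.1‖ (weightedEntire.toEntire W g) fun z => by
      change ‖W z * g.1 z‖ ≤ _
      rw [norm_mul, hW, mul_comm]
      exact mul_le_mul_of_nonneg_right (g.1.norm_coe_le_norm z) (Real.exp_pos _).le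
    obtain ⟨C, hC⟩ := exists_bound_of_tendsto hh hK
    exact ⟨C, fun p => hC p.1 p.2.1 p.2.2⟩
  obtain ⟨C, hC⟩ := banach_steinhaus hΦ
  refine ⟨max C 0, fun i A f hf z hz => ?_⟩
  have hW0 : ∀ z, W z ≠ 0 := fun z => norm_ne_zero_iff.1 (by rw [hW]; exact (Real.exp_pos _).ne')
  -- The growth bound says exactly that f = W g with ‖g‖ ≤ A.
  let g : (ι → ℂ) →ᵇ ℂ := BoundedContinuousFunction.ofNormedAddCommGroup
    (fun z => (W z)⁻¹ * f.1 z) ((W.continuous.inv₀ hW0).mul f.1.continuous) A fun z => by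
      rw [norm_mul, norm_inv, hW, inv_mul_le_iff₀ (Real.exp_pos _), mul_comm]
      exact hf z
  have hg : ‖g‖ ≤ A := BoundedContinuousFunction.norm_ofNormedAddCommGroup_le _ hf.nonneg _
  have hgf : mulWeight W g = f.1 := ContinuousMap.ext fun z => mul_inv_cancel_left₀ (hW0 z) _
  have hmem : g ∈ weightedEntire W := by
    change mulWeight W g ∈ entireSubmodule ι
    rw [hgf]
    exact f.2
  have hto : weightedEntire.toEntire W ⟨g, hmem⟩ = f := Subtype.ext hgf
  have h1 : ‖Φ (i, ⟨z, hz⟩) ⟨g, hmem⟩‖ ≤ max C 0 * A :=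
    ((Φ (i, ⟨z, hz⟩)).le_opNorm _).trans
      (mul_le_mul ((hC _).trans (le_max_left _ _)) hg (norm_nonneg _) (le_max_right _ _))
  have h2 : Φ (i, ⟨z, hz⟩) ⟨g, hmem⟩ = (T i f).1 z := by
    change (T i (weightedEntire.toEntire W ⟨g, hmem⟩)).1 z = _
    rw [hto]
  rwa [h2] at h1

end UniformBound

/-! ### Geometric decay of the Newton summands -/

section Decay

variable {ι : Type} [Fintype ι] {ω : ℝ} {N : PCNorm ι}

theorem NewtonSequence.tendsto_summand {𝒩 : NewtonSequence ι} {f : Entire ι}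
    (h : Tendsto (fun d => 𝒩.proj d f) atTop (𝓝 f)) :
    Tendsto (fun d => 𝒩.summand d f) atTop (𝓝 0) := by
  rw [← tendsto_add_atTop_iff_nat 1]
  simpa [summand] using ((tendsto_add_atTop_iff_nat 1).2 h).sub h

/-- The remainder of the Taylor series of a function with a growth condition. -/
theorem ExpBound.sub_taylorSum [DecidableEq ι] {t A r : ℝ} (hr : 1 < r)
    {f : Entire ι} (hf : ExpBound ω N t A f) (n : ℕ) :
    ExpBound ω N (t * r ^ ω) (A * (1 - r⁻¹)⁻¹ * r⁻¹ ^ n) (f - taylorSum f n) := by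
  intro z
  have hr0 : 0 < r := one_pos.trans hr
  have hN : 0 ≤ N.toSeminorm z := apply_nonneg _ _
  set B := A * Real.exp (t * r ^ ω * N.toSeminorm z ^ ω)
  -- Cauchy's inequality on the circle of radius r gains r⁻¹ per degree and raises the rate from t
  -- to t * r ^ ω.
  have hterm : ∀ k, ‖taylorHom f.1 (k + n) z‖ ≤ B * r⁻¹ ^ n * r⁻¹ ^ k := fun k => by
    have := norm_taylorHom_le (f := f.1) f.2 (k + n) z hr0 (C := B) fun s hs => by
      refine (hf _).trans_eq ?_
      rw [map_smul_eq_mul, hs, Real.mul_rpow hr0.le hN, ← mul_assoc]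
    rwa [div_eq_mul_inv, ← inv_pow, pow_add, mul_comm (r⁻¹ ^ k), ← mul_assoc] at this
  have hs : HasSum (fun k => taylorHom f.1 (k + n) z) ((f - taylorSum f n).1 z) := by
    have e : (f - taylorSum f n).1 z = f.1 z - ∑ k ∈ Finset.range n, taylorHom f.1 k z := by
      rw [← taylorSum_apply]
      rfl
    rw [e]
    exact (hasSum_nat_add_iff' n).2 (hasSum_taylorHom (f := f.1) f.2 z)
  have hg := (hasSum_geometric_of_lt_one (inv_nonneg.2 hr0.le) (inv_lt_one_of_one_lt₀ hr)).mul_left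
    (B * r⁻¹ ^ n)
  have h := tsum_of_norm_bounded hg hterm
  rw [hs.tsum_eq] at h
  refine h.trans_eq ?_
  simp only [B]
  ring

/-- The gap between t and τ pays for the decay: the i-th summand sees only the Taylor remainder from
degree i on, which is of order r⁻¹ ^ i at a rate t' < τ where the summands are uniformly bounded. -/
theorem NewtonSequence.exists_decay {𝒩 : NewtonSequence ι} {t τ : ℝ} (hω : 0 < ω) (ht : 0 < t)
    (htτ : t < τ) (h : 𝒩.ConvergesOn (entireOfTypeLT ω N τ)) {K : Set (ι → ℂ)}
    (hK : IsCompact K) :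
    ∃ C q, 0 ≤ q ∧ q < 1 ∧ ∀ i A f, ExpBound ω N t A f → ∀ z ∈ K,
      ‖(𝒩.summand i f).1 z‖ ≤ C * A * q ^ i := by
  classical
  obtain ⟨t', htt', ht'τ⟩ := exists_between htτ
  have ht' : 0 < t' := ht.trans htt'
  obtain ⟨C, hC⟩ := exists_uniform_bound (t := t') (N := N) (T := 𝒩.summand) hω
    (fun A f hf => ⟨0, tendsto_summand (h f (hf.mem hω ht'.le ht'τ))⟩) hK
  -- Chosen so that t * r ^ ω = t'.
  set r := (t' / t) ^ (1 / ω)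
  have hr : 1 < r := Real.one_lt_rpow ((one_lt_div ht).2 htt') (one_div_pos.2 hω)
  have hrω : t * r ^ ω = t' := by
    rw [← Real.rpow_mul (div_pos ht' ht).le, one_div_mul_cancel hω.ne', Real.rpow_one,
      mul_div_cancel₀ _ ht.ne']
  have hr0 : 0 < r := one_pos.trans hr
  have hr1 : r⁻¹ < 1 := inv_lt_one_of_one_lt₀ hr
  refine ⟨C * (1 - r⁻¹)⁻¹, r⁻¹, inv_nonneg.2 hr0.le, hr1, fun i A f hf z hz => ?_⟩
  have hb := hf.sub_taylorSum hr i
  rw [hrω] at hb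
  have h1 := hC i _ _ hb z hz
  have h2 : 𝒩.summand i (taylorSum f i) = 0 := by
    cases i with
    | zero => rw [taylorSum, Finset.sum_range_zero, map_zero]
    | succ i => exact 𝒩.summand_eq_zero i.lt_succ_self (isPolyDegreeLE_taylorSum f i)
  rw [map_sub, h2, sub_zero] at h1
  refine h1.trans_eq ?_
  ring

end Decay

/-! ### Convergence of the Newton product -/

section Convergence

variable {ι₁ ι₂ : Type} [Fintype ι₁] [Fintype ι₂] {ω : ℝ} {N₁ : PCNorm ι₁} {N₂ : PCNorm ι₂}
  {𝒩₁ : NewtonSequence ι₁} {𝒩₂ : NewtonSequence ι₂}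

theorem tendsto_simplexPairs : Tendsto simplexPairs atTop atTop := by
  refine tendsto_atTop_finset_of_monotone (fun d e h p hp => ?_) fun p => ⟨p.1 + p.2, ?_⟩
  · rw [mem_simplexPairs] at hp ⊢
    exact hp.trans h
  · rw [mem_simplexPairs]

theorem NewtonSequence.tsum_summand {ι : Type} [Fintype ι] {𝒩 : NewtonSequence ι} {f : Entire ι}
    (h : Tendsto (fun d => 𝒩.proj d f) atTop (𝓝 f)) {z : ι → ℂ}
    (hs : Summable fun i => (𝒩.summand i f).1 z) : ∑' i, (𝒩.summand i f).1 z = f.1 z := by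
  have h1 : Tendsto (fun d => (𝒩.proj d f).1 z) atTop (𝓝 (f.1 z)) :=
    ((Entire.evalCLM z).cont.tendsto f).comp h
  have h2 := (tendsto_add_atTop_iff_nat 1).2 hs.hasSum.tendsto_sum_nat
  have e : (fun d => ∑ i ∈ Finset.range (d + 1), (𝒩.summand i f).1 z)
      = fun d => (𝒩.proj d f).1 z := funext fun d => by
    rw [← 𝒩.sum_summand_apply, ← Entire.evalCLM_apply, map_sum]
    rfl
  rw [e] at h2
  exact tendsto_nhds_unique h2 h1

/-- Freezing w, decay in the second factor gives a bound in w that still grows at rate t₁, to which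
decay in the first factor applies. Absolute summability permits both the simplex ordering and
iterated summation. -/
theorem tendsto_productProj {t₁ t₂ τ₁ τ₂ A : ℝ} (hω : 0 < ω) (ht₁ : 0 < t₁) (ht₂ : 0 < t₂)
    (htτ₁ : t₁ < τ₁) (htτ₂ : t₂ < τ₂) (h₁ : 𝒩₁.ConvergesOn (entireOfTypeLT ω N₁ τ₁))
    (h₂ : 𝒩₂.ConvergesOn (entireOfTypeLT ω N₂ τ₂)) {f : Entire (ι₁ ⊕ ι₂)}
    (hf : ∀ w z, ‖f.1 (Sum.elim w z)‖ ≤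
      A * Real.exp (t₁ * N₁.toSeminorm w ^ ω) * Real.exp (t₂ * N₂.toSeminorm z ^ ω)) :
    Tendsto (fun d => productProj 𝒩₁ 𝒩₂ d f) atTop (𝓝 f) := by
  rw [Entire.tendsto_iff]
  intro K hK
  have hK₁ : IsCompact ((fun (z : ι₁ ⊕ ι₂ → ℂ) (i : ι₁) => z (Sum.inl i)) '' K) :=
    hK.image (by fun_prop)
  have hK₂ : IsCompact ((fun (z : ι₁ ⊕ ι₂ → ℂ) (j : ι₂) => z (Sum.inr j)) '' K) :=
    hK.image (by fun_prop)
  obtain ⟨C₁, q₁, hq₁, hq₁', hd₁⟩ := 𝒩₁.exists_decay hω ht₁ htτ₁ h₁ hK₁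
  obtain ⟨C₂, q₂, hq₂, hq₂', hd₂⟩ := 𝒩₂.exists_decay hω ht₂ htτ₂ h₂ hK₂
  have hslice : ∀ w, ExpBound ω N₂ t₂ (A * Real.exp (t₁ * N₁.toSeminorm w ^ ω)) (f.slice w) :=
    fun w z => hf w z
  have hpart : ∀ j, ∀ z ∈ K, ExpBound ω N₁ t₁ (C₂ * A * q₂ ^ j)
      (partialApply (𝒩₂.summand j) f fun j => z (Sum.inr j)) := fun j z hz w => by
    refine (hd₂ j _ _ (hslice w) _ ⟨z, hz, rfl⟩).trans_eq ?_
    ring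
  have hterm : ∀ (p : ℕ × ℕ), ∀ z ∈ K,
      ‖(tensorCLM (𝒩₁.summand p.1) (𝒩₂.summand p.2) f).1 z‖
        ≤ C₁ * C₂ * A * (q₁ ^ p.1 * q₂ ^ p.2) := fun p z hz => by
    rw [tensorCLM_apply]
    refine (hd₁ p.1 _ _ (hpart p.2 z hz) _ ⟨z, hz, rfl⟩).trans_eq ?_
    ring
  have hsum : Summable fun p : ℕ × ℕ => C₁ * C₂ * A * (q₁ ^ p.1 * q₂ ^ p.2) :=
    ((summable_geometric_of_lt_one hq₁ hq₁').mul_of_nonneg (summable_geometric_of_lt_one hq₂ hq₂')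
      (fun i => pow_nonneg hq₁ i) (fun j => pow_nonneg hq₂ j)).mul_left _
  have hpt : Set.EqOn (fun z => ∑' p : ℕ × ℕ,
      (tensorCLM (𝒩₁.summand p.1) (𝒩₂.summand p.2) f).1 z) f.1 K := fun z hz => by
    have hs : Summable fun p : ℕ × ℕ => (tensorCLM (𝒩₁.summand p.1) (𝒩₂.summand p.2) f).1 z :=
      Summable.of_norm_bounded hsum fun p => hterm p z hz
    have hs' : Summable fun p : ℕ × ℕ =>
        (tensorCLM (𝒩₁.summand p.2) (𝒩₂.summand p.1) f).1 z :=
      (Equiv.prodComm ℕ ℕ).summable_iff.2 hs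
    change ∑' p : ℕ × ℕ, (tensorCLM (𝒩₁.summand p.1) (𝒩₂.summand p.2) f).1 z = f.1 z
    -- The outer sum must run over j: for fixed j the inner sum is the Newton series of
    -- `partialApply`.
    rw [← (Equiv.prodComm ℕ ℕ).tsum_eq]
    refine hs'.tsum_prod.trans ?_
    have e : ∀ j, ∑' i, (tensorCLM (𝒩₁.summand i) (𝒩₂.summand j) f).1 z
        = (𝒩₂.summand j (f.slice fun i => z (Sum.inl i))).1 fun j => z (Sum.inr j) := fun j => by
      simp only [tensorCLM_apply]
      refine NewtonSequence.tsum_summand (h₁ _ ((hpart j z hz).mem hω ht₁.le htτ₁)) ?_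
      exact hs'.prod_factor j
    refine (tsum_congr e).trans ?_
    refine (NewtonSequence.tsum_summand (h₂ _ ((hslice _).mem hω ht₂.le htτ₂)) ?_).trans ?_
    · exact hs'.prod.congr e
    · rw [Entire.slice_apply]
      congr 1
      ext k
      rcases k with i | j <;> rfl
  have hu := (tendstoUniformlyOn_tsum hsum fun p z hz => hterm p z hz).congr_right hpt
  have hu' : TendstoUniformlyOn (fun d z => ∑ p ∈ simplexPairs d,
      (tensorCLM (𝒩₁.summand p.1) (𝒩₂.summand p.2) f).1 z) f.1 atTop K :=
    fun u hu'' => tendsto_simplexPairs.eventually (hu u hu'')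
  convert hu' using 3 with d z
  rw [productProj_apply, ← Entire.evalCLM_apply, map_sum]
  rfl

/-- Subadditivity of x ↦ x^ω splits the bound exp(t N^ω) into factors with rates a_s^ω t < τ_s. Both
convergence claims are choices of weights: a_s = τ_s^(1/ω) with τ = 1, and a_s = 1. -/
theorem convergesOn_newtonProduct {τ₁ τ₂ τ a₁ a₂ : ℝ} (hω : 0 < ω) (hω₁ : ω ≤ 1) (hτ : 0 < τ)
    (ha₁ : 0 < a₁) (ha₂ : 0 < a₂) (e₁ : a₁ ^ ω * τ = τ₁) (e₂ : a₂ ^ ω * τ = τ₂)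
    (h₁ : 𝒩₁.ConvergesOn (entireOfTypeLT ω N₁ τ₁))
    (h₂ : 𝒩₂.ConvergesOn (entireOfTypeLT ω N₂ τ₂)) :
    (newtonProduct 𝒩₁ 𝒩₂).ConvergesOn
      (entireOfTypeLT ω (PCNorm.weightedSum a₁ a₂ ha₁ ha₂ N₁ N₂) τ) := by
  intro f hf
  obtain ⟨t, A, ht, htτ, hb⟩ := exists_expBound_of_mem hτ hf
  have p₁ : 0 < a₁ ^ ω := Real.rpow_pos_of_pos ha₁ _
  have p₂ : 0 < a₂ ^ ω := Real.rpow_pos_of_pos ha₂ _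
  refine tendsto_productProj (A := A) hω (mul_pos p₁ ht) (mul_pos p₂ ht)
    (by rw [← e₁]; exact mul_lt_mul_of_pos_left htτ p₁)
    (by rw [← e₂]; exact mul_lt_mul_of_pos_left htτ p₂) h₁ h₂ fun w z => ?_
  have hw : 0 ≤ N₁.toSeminorm w := apply_nonneg _ _
  have hz : 0 ≤ N₂.toSeminorm z := apply_nonneg _ _
  refine (hb _).trans ?_
  rw [mul_assoc A, ← Real.exp_add]
  refine mul_le_mul_of_nonneg_left (Real.exp_le_exp.2 ?_) hb.nonneg
  have e : (PCNorm.weightedSum a₁ a₂ ha₁ ha₂ N₁ N₂).toSeminorm (Sum.elim w z)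
      = a₁ * N₁.toSeminorm w + a₂ * N₂.toSeminorm z := rfl
  rw [e]
  have h := Real.rpow_add_le_add_rpow (mul_nonneg ha₁.le hw) (mul_nonneg ha₂.le hz) hω.le hω₁
  rw [Real.mul_rpow ha₁.le hw, Real.mul_rpow ha₂.le hz] at h
  refine (mul_le_mul_of_nonneg_left h ht.le).trans_eq ?_
  ring

end Convergence

end

theorem mainTheorem4 (n₁ n₂ : ℕ) (hn₁ : 1 ≤ n₁) (hn₂ : 1 ≤ n₂)
    (ω : ℝ) (hω₀ : 0 < ω) (hω₁ : ω ≤ 1)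
    (N₁ : PCNorm (Fin n₁)) (N₂ : PCNorm (Fin n₂))
    (𝒩₁ : NewtonSequence (Fin n₁)) (𝒩₂ : NewtonSequence (Fin n₂)) :
    (∃! 𝒩 : NewtonSequence (Fin n₁ ⊕ Fin n₂), IsNewtonProduct 𝒩₁ 𝒩₂ 𝒩) ∧
    ∀ 𝒩 : NewtonSequence (Fin n₁ ⊕ Fin n₂), IsNewtonProduct 𝒩₁ 𝒩₂ 𝒩 →
      (∀ (τ₁ τ₂ : ℝ) (hτ₁ : 0 < τ₁) (hτ₂ : 0 < τ₂),
        𝒩₁.ConvergesOn (entireOfTypeLT ω N₁ τ₁) →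
        𝒩₂.ConvergesOn (entireOfTypeLT ω N₂ τ₂) →
        𝒩.ConvergesOn (entireOfTypeLT ω
          (PCNorm.weightedSum (τ₁ ^ (1 / ω)) (τ₂ ^ (1 / ω))
            (Real.rpow_pos_of_pos hτ₁ _) (Real.rpow_pos_of_pos hτ₂ _) N₁ N₂) 1)) ∧
      (∀ τ : ℝ, 0 < τ →
        𝒩₁.ConvergesOn (entireOfTypeLT ω N₁ τ) →
        𝒩₂.ConvergesOn (entireOfTypeLT ω N₂ τ) →
        𝒩.ConvergesOn (entireOfTypeLT ω
          (PCNorm.weightedSum 1 1 one_pos one_pos N₁ N₂) τ)) := by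
  refine ⟨⟨newtonProduct 𝒩₁ 𝒩₂, isNewtonProduct_newtonProduct, fun 𝒩 h => h.eq_newtonProduct⟩,
    fun 𝒩 h => ?_⟩
  obtain rfl := h.eq_newtonProduct
  refine ⟨fun τ₁ τ₂ hτ₁ hτ₂ h₁ h₂ => ?_, fun τ hτ h₁ h₂ => ?_⟩
  · have e : ∀ {τ : ℝ}, 0 < τ → (τ ^ (1 / ω)) ^ ω * 1 = τ := fun hτ => by
      rw [← Real.rpow_mul hτ.le, one_div_mul_cancel hω₀.ne', Real.rpow_one, mul_one]
    exact convergesOn_newtonProduct hω₀ hω₁ one_pos _ _ (e hτ₁) (e hτ₂) h₁ h₂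
  · have e : (1 : ℝ) ^ ω * τ = τ := by rw [Real.one_rpow, one_mul]
    exact convergesOn_newtonProduct hω₀ hω₁ hτ _ _ e e h₁ h₂
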